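/- Let $H$ be a real separable Hilbert space with norm $|\cdot|$, let $(S_t)_{t\ge0}$ be a $C_0$-semigroup on $H$ with generator $A$, and let $p>0$. Then there exist finite constants $C(t,p,A)\ge 0$, $t\ge0$, depending only on $t$, $p$ and the semigroup, such that the following holds. Let $U$ be a Hilbert space with a continuous, dense, injective embedding $H\subset U$, such that for every $t\in(0,1]$ the operator $S_t$ extends to a bounded operator $S_t:U\to H$ (hence so does $S_t$ for every $t>0$). Let $Y=(Y_t)_{t\ge0}$ be a $U$-valued Lévy process (in particular, it may be a pure jump one), adapted to a stochastic basis $(\Omega,\mathscr F,(\mathscr F_t)_{t\ge0},\mathbb P)$ satisfying the usual conditions. For a partition $0=s_0\le s_1\le\dots\le s_n=t$ consider the Stieltjes sums $$\sum_{i<n}S_{s_{i+1}}\left(Y_{s_{i+1}}-Y_{s_i}\right)\qquad\text{and}\qquad \sum_{i<n}S_{t-s_i}\left(Y_{s_{i+1}}-Y_{s_i}\right),$$ and let $\int_0^tS_s\,dY_s$ and $\int_0^tS_{t-s}\,dY_s$, respectively, denote their limits in probability in $H$, as the mesh of the partition tends to $0$, whenever these exist. (Terms with $s_i=s_{i+1}$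 are $0$.) Assume that for every $t\in(0,1]$ the integral $\int_0^tS_s\,dY_s$ exists, that $$\gamma_p=\sup_{t\in(0,1]}\mathbb E\left|\int_0^tS_s\,dY_s\right|^p<\infty,\qquad\text{and that}\qquad \lim_{t\downarrow0}\mathbb E\left|\int_0^tS_s\,dY_s\right|^p=0 .$$ Then the stochastic convolution $Y_A(t)=\int_0^tS_{t-s}\,dY_s$ exists for every $t\ge0$, and 1. $\mathbb E|Y_A(t)|^p\le\gamma_p\,C(t,p,A)$ for every $t\ge0$; 2. $Y_A$ is continuous in $p$-th mean: $\lim_{s\to t}\mathbb E|Y_A(s)-Y_A(t)|^p=0$ for every $t\ge0$; 3. $Y_A$ admits a predictable modification: there is an $H$-valued predictable process $V$ with $V_t=Y_A(t)$ almost surely for every $t\ge0$. -/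

import Mathlib

open MeasureTheory ProbabilityTheory Filter Topology
open scoped NNReal ENNReal

/-- A strongly continuous semigroup (`C₀`-semigroup) of bounded linear operators on `H`. -/
structure IsC0Semigroup {H : Type*} [NormedAddCommGroup H] [NormedSpace ℝ H]
    (S : ℝ≥0 → H →L[ℝ] H) : Prop where
  zero : S 0 = ContinuousLinearMap.id ℝ H
  add : ∀ s t : ℝ≥0, S (s + t) = (S s).comp (S t)
  continuous : ∀ x : H, Continuous fun t => S t x

/-- The bounded extension `U → H` of an operator `A : H → H` along an embedding `j : H → U`
with dense range. When a bounded extension exists it is unique, by density; if there is none the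
value is `0`. -/
noncomputable def boundedExtension {H U : Type*} [NormedAddCommGroup H] [NormedSpace ℝ H]
    [NormedAddCommGroup U] [NormedSpace ℝ U] (j : H →L[ℝ] U) (A : H →L[ℝ] H) : U →L[ℝ] H :=
  open scoped Classical in
  if h : ∃ T : U →L[ℝ] H, T.comp j = A then h.choose else 0

theorem boundedExtension_eq {H U : Type*} [NormedAddCommGroup H] [NormedSpace ℝ H]
    [NormedAddCommGroup U] [NormedSpace ℝ U] {j : H →L[ℝ] U} (hj : DenseRange j)
    {A : H →L[ℝ] H} {T : U →L[ℝ] H} (hT : T.comp j = A) : boundedExtension j A = T := by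
  have h : ∃ T : U →L[ℝ] H, T.comp j = A := ⟨T, hT⟩
  have h1 : boundedExtension j A = h.choose := by
    unfold boundedExtension
    rw [dif_pos h]
  have h2 : (boundedExtension j A).comp j = T.comp j := by rw [h1, h.choose_spec, hT]
  apply ContinuousLinearMap.coeFn_injective
  refine hj.equalizer (boundedExtension j A).continuous T.continuous ?_
  funext x
  exact DFunLike.congr_fun h2 x

/-- The usual conditions: `𝓕 0` contains every `P`-null set (so that `P` is complete), and the
filtration is right-continuous. -/
structure UsualConditions {Ω : Type*} {m : MeasurableSpace Ω} (𝓕 : Filtration ℝ≥0 m)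
    (P : Measure Ω) : Prop where
  null : ∀ N : Set Ω, P N = 0 → MeasurableSet[𝓕 0] N
  right_continuous : 𝓕.IsRightContinuous

/-- `Y` is a Lévy process (in law): it starts at `0`, it has independent and stationary
increments, and it is stochastically continuous. -/
structure IsLevyProcess {Ω U : Type*} {m : MeasurableSpace Ω} [NormedAddCommGroup U]
    [MeasurableSpace U] (Y : ℝ≥0 → Ω → U) (P : Measure Ω) : Prop where
  start : ∀ᵐ ω ∂P, Y 0 ω = 0
  indep : HasIndepIncrements Y P
  stationary : ∀ s h : ℝ≥0, IdentDistrib (fun ω => Y (s + h) ω - Y s ω) (Y h) P P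
  stochCont : ∀ t : ℝ≥0, TendstoInMeasure P Y (𝓝 t) (Y t)

/-- A partition `0 = pt 0 ≤ pt 1 ≤ … ≤ pt n = t` of `[0, t]`; the values of `pt` beyond `n` play
no role. -/
structure TimePartition (t : ℝ≥0) where
  n : ℕ
  pt : ℕ → ℝ≥0
  mono : Monotone pt
  pt_zero : pt 0 = 0
  pt_n : pt n = t

/-- The length of the longest interval of a partition. -/
noncomputable def TimePartition.mesh {t : ℝ≥0} (π : TimePartition t) : ℝ≥0 :=
  (Finset.range π.n).sup fun i => π.pt (i + 1) - π.pt i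

/-- The limit over all partitions of `[0, t]`, as the mesh tends to `0`. -/
noncomputable def meshFilter (t : ℝ≥0) : Filter (TimePartition t) :=
  comap TimePartition.mesh (𝓝 0)

/-- The Stieltjes sum `∑ Φ(ξ i) (Y (pt (i + 1)) - Y (pt i))` with evaluation points `ξ i`. -/
noncomputable def stieltjesSum {Ω U H : Type*} [NormedAddCommGroup U] [NormedSpace ℝ U]
    [NormedAddCommGroup H] [NormedSpace ℝ H] (Φ : ℝ≥0 → U →L[ℝ] H) (Y : ℝ≥0 → Ω → U)
    {t : ℝ≥0} (π : TimePartition t) (ξ : ℕ → ℝ≥0) (ω : Ω) : H :=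
  ∑ i ∈ Finset.range π.n, Φ (ξ i) (Y (π.pt (i + 1)) ω - Y (π.pt i) ω)

/-- `J` is (a version of) the stochastic integral `∫_0^t Φ(s) dY_s`, as the limit in probability
of the Stieltjes sums. The integrand, which may be undefined or singular at `s = 0`, is evaluated
at the right end of each interval. -/
def IsStochIntegral {Ω U H : Type*} {m : MeasurableSpace Ω} [NormedAddCommGroup U]
    [NormedSpace ℝ U] [NormedAddCommGroup H] [NormedSpace ℝ H] (P : Measure Ω)
    (Φ : ℝ≥0 → U →L[ℝ] H) (Y : ℝ≥0 → Ω → U) (t : ℝ≥0) (J : Ω → H) : Prop :=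
  AEStronglyMeasurable J P ∧
    TendstoInMeasure P
      (fun π : TimePartition t => stieltjesSum Φ Y π fun i => π.pt (i + 1)) (meshFilter t) J

/-- `J` is (a version of) the stochastic convolution integral `∫_0^t Φ(t - s) dY_s`, as the limit
in probability of the Stieltjes sums. The integrand, which may be undefined or singular at
`s = t`, is evaluated at the left end of each interval. -/
def IsStochConvolution {Ω U H : Type*} {m : MeasurableSpace Ω} [NormedAddCommGroup U]
    [NormedSpace ℝ U] [NormedAddCommGroup H] [NormedSpace ℝ H] (P : Measure Ω)
    (Φ : ℝ≥0 → U →L[ℝ] H) (Y : ℝ≥0 → Ω → U) (t : ℝ≥0) (J : Ω → H) : Prop :=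
  AEStronglyMeasurable J P ∧
    TendstoInMeasure P
      (fun π : TimePartition t => stieltjesSum (fun s => Φ (t - s)) Y π π.pt) (meshFilter t) J

/-! Three ideas carry the theorem: time reversal, the flow property, and stationarity.

Time reversal: for fixed `t`, the increments of `Y` after time `a`, stopped at `a + t`, form a
process with the same law as `u ↦ Y t - Y (t - u)`. Reversal turns the right-endpoint sums of the
integral into the left-endpoint sums of a convolution. Being Cauchy in probability depends only on
the law of the driving process, so for `0 < t ≤ 1` the convolution exists and has the law of `∫_0^t
S_s dY_s` (`IsLevyProcess.exists_convolution_of_integral`,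
`IsLevyProcess.identDistrib_convolution_integral`).

Flow property: the convolution over `[0, a + b]` is `S b` applied to that over `[0, a]`, plus a
convolution driven by the increments after `a` (`IsStochConvolution.add_time`). Iterating over equal
steps of length at most one gives existence at all times and the moment bound.

Continuity from the right follows from one step of the flow and strong continuity of `S`. From the
left, `S h - 1` acts on a convolution at a moving time; stationarity moves it to the fixed time
(`IsLevyProcess.lintegral_semigroup_sub_le`). Continuity in mean gives continuity in probability,
and an adapted process continuous in probability is almost surely, at each time, the limit of
predictable step processes (`exists_predictable_modification`). -/

/-- Path laws are determined by finite-dimensional laws, and these are images of products of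
increment laws under partial summation. -/
theorem ProbabilityTheory.HasIndepIncrements.identDistrib_process {T Ω E : Type*}
    [LinearOrder T] [OrderBot T]
    {m : MeasurableSpace Ω} {P : Measure Ω} [IsProbabilityMeasure P] [NormedAddCommGroup E]
    [NormedSpace ℝ E] [MeasurableSpace E] [BorelSpace E] [SecondCountableTopology E]
    {X X' : T → Ω → E}
    (hX : ∀ t, Measurable (X t)) (hX' : ∀ t, Measurable (X' t))
    (h0 : ∀ᵐ ω ∂P, X ⊥ ω = 0) (h0' : ∀ᵐ ω ∂P, X' ⊥ ω = 0)
    (hi : HasIndepIncrements X P) (hi' : HasIndepIncrements X' P)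
    (h : ∀ s t, s ≤ t →
      IdentDistrib (fun ω => X t ω - X s ω) (fun ω => X' t ω - X' s ω) P P) :
    IdentDistrib (fun ω t => X t ω) (fun ω t => X' t ω) P P := by
  have hm : Measurable (fun ω t => X t ω) := measurable_pi_lambda _ hX
  have hm' : Measurable (fun ω t => X' t ω) := measurable_pi_lambda _ hX'
  refine (identDistrib_iff_forall_finset_identDistrib hm.aemeasurable hm'.aemeasurable).2
    fun I => ?_
  -- The points of `I` in increasing order, preceded by `⊥`, where the processes vanish almost
  -- surely; `g` recovers the values as partial sums.
  let t : Fin (I.card + 1) → T := Fin.cases ⊥ (I.orderEmbOfFin rfl)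
  let g : (Fin I.card → E) → (I → E) := fun x u => ∑ k ≤ (I.orderIsoOfFin rfl).symm u, x k
  have hg : Measurable g := by fun_prop
  have hmono : Monotone t := by
    intro i k hik
    induction i using Fin.cases with
    | zero => exact (bot_le : (⊥ : T) ≤ t k)
    | succ i =>
      induction k using Fin.cases with
      | zero => simp at hik
      | succ k => exact (I.orderEmbOfFin rfl).monotone (by simpa using hik)
  have aux : ∀ Z : T → Ω → E, (∀ᵐ ω ∂P, Z ⊥ ω = 0) → (fun ω => I.restrict (fun s => Z s ω)) =ᵐ[P]
      g ∘ (fun ω i => Z (t (Fin.succ i)) ω - Z (t i.castSucc) ω) := by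
    intro Z hZ
    filter_upwards [hZ] with ω hω
    ext u
    simp only [Finset.restrict, g, Function.comp_apply]
    rw [Fin.sum_Iic_sub _ (fun k => Z (t k) ω)]
    simp [hω, t, Finset.orderEmbOfFin]
  have e := aux X h0
  have e' := aux X' h0'
  have key : IdentDistrib
      (fun ω i => X (t (Fin.succ i)) ω -
        X (t i.castSucc) ω)
      (fun ω i => X' (t (Fin.succ i)) ω -
        X' (t i.castSucc) ω) P P := by
    refine ⟨by fun_prop, by fun_prop, ?_⟩
    rw [(iIndepFun_iff_map_fun_eq_pi_map (by fun_prop)).1 (hi _ _ hmono),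
      (iIndepFun_iff_map_fun_eq_pi_map (by fun_prop)).1 (hi' _ _ hmono)]
    congr 1
    funext i
    exact (h _ _ (hmono (Fin.castSucc_le_succ i))).map_eq
  have key' := key.comp hg
  refine ⟨((Finset.measurable_restrict I).comp hm).aemeasurable,
    ((Finset.measurable_restrict I).comp hm').aemeasurable, ?_⟩
  rw [Measure.map_congr e, Measure.map_congr e']
  exact key'.map_eq

/-- Completeness of convergence in probability along a countably generated filter: a fast Cauchy
sequence converges almost surely by Borel–Cantelli, and its limit serves the whole filter. -/
theorem MeasureTheory.exists_tendstoInMeasure_of_cauchy {ι Ω E : Type*} {m : MeasurableSpace Ω} {P : Measure Ω}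
    [IsFiniteMeasure P] [NormedAddCommGroup E] [CompleteSpace E] {l : Filter ι} [NeBot l]
    [IsCountablyGenerated l] {f : ι → Ω → E} (hf : ∀ i, AEStronglyMeasurable (f i) P)
    (hc : ∀ ε : ℝ≥0∞, 0 < ε →
      Tendsto (fun q : ι × ι => P {ω | ε ≤ edist (f q.1 ω) (f q.2 ω)}) (l ×ˢ l) (𝓝 0)) :
    ∃ J : Ω → E, AEStronglyMeasurable J P ∧ TendstoInMeasure P f l J := by
  have hA : ∀ ε : ℝ≥0∞, 0 < ε → ∀ δ : ℝ≥0∞, 0 < δ → ∃ A ∈ l, ∀ i ∈ A, ∀ j ∈ A,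
      P {ω | ε ≤ edist (f i ω) (f j ω)} ≤ δ := by
    intro ε hε δ hδ
    have h1 := (hc ε hε).eventually (Iic_mem_nhds hδ)
    obtain ⟨A, hA, h2⟩ := (eventually_prod_self_iff (r := fun i k =>
      P {ω | ε ≤ edist (f i ω) (f k ω)} ≤ δ)).1 h1
    exact ⟨A, hA, fun i hi j hj => h2 i hi j hj⟩
  have hpos : ∀ n : ℕ, 0 < ((2 : ℝ≥0∞)⁻¹) ^ n := fun n => ENNReal.pow_pos (by simp) n
  choose A hAl hAP using fun n : ℕ => hA _ (hpos n) _ (hpos n)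
  obtain ⟨B, hB⟩ := l.exists_antitone_basis
  have hne : ∀ n, ((⋂ k ∈ Set.Iic n, A k) ∩ B n).Nonempty := fun n =>
    l.nonempty_of_mem (inter_mem ((biInter_mem (Set.finite_Iic n)).2 fun k _ => hAl k) (hB.mem n))
  choose x hx using hne
  have hxA : ∀ n k, k ≤ n → x n ∈ A k := fun n k hk => Set.mem_iInter₂.1 (hx n).1 k hk
  have hxl : Tendsto x atTop l := by
    refine hB.tendsto_right_iff.2 fun n _ => ?_
    filter_upwards [eventually_ge_atTop n] with k hk using hB.antitone hk (hx k).2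
  have hsum : ∑' n, P {ω | ((2 : ℝ≥0∞)⁻¹) ^ n ≤ edist (f (x n) ω) (f (x (n + 1)) ω)} ≠ ∞ := by
    refine ne_top_of_le_ne_top ?_ (ENNReal.tsum_le_tsum fun n =>
      hAP n _ (hxA n n le_rfl) _ (hxA (n + 1) n n.le_succ))
    rw [ENNReal.tsum_geometric, ENNReal.one_sub_inv_two, inv_inv]
    exact ENNReal.ofNat_ne_top
  have hlim : ∀ᵐ ω ∂P, ∃ y, Tendsto (fun n => f (x n) ω) atTop (𝓝 y) := by
    filter_upwards [ae_eventually_notMem hsum] with ω hω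
    refine cauchySeq_tendsto_of_complete (cauchySeq_of_summable_dist ?_)
    refine Summable.of_norm_bounded_eventually_nat (g := fun n => (2⁻¹ : ℝ) ^ n)
      (summable_geometric_of_lt_one (by norm_num) (by norm_num)) ?_
    filter_upwards [hω] with n hn
    rw [not_le] at hn
    rw [Real.norm_of_nonneg dist_nonneg, ← edist_le_ofReal (by positivity)]
    refine hn.le.trans (le_of_eq ?_)
    rw [ENNReal.ofReal_pow (by positivity), ENNReal.ofReal_inv_of_pos (by norm_num)]
    simp
  obtain ⟨J, hJ, hJlim⟩ := exists_stronglyMeasurable_limit_of_tendsto_ae (fun n => hf (x n)) hlim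
  refine ⟨J, hJ.aestronglyMeasurable, ?_⟩
  have hJm := tendstoInMeasure_of_tendsto_ae (fun n => hf (x n)) hJlim
  intro ε hε
  rw [ENNReal.tendsto_nhds_zero]
  intro δ hδ
  obtain ⟨D, hD, hDP⟩ := hA (ε / 2) (ENNReal.half_pos hε.ne') (δ / 2) (ENNReal.half_pos hδ.ne')
  obtain ⟨n, hn1, hn2⟩ := ((hxl.eventually hD).and
    ((hJm (ε / 2) (ENNReal.half_pos hε.ne')).eventually
      (Iic_mem_nhds (ENNReal.half_pos hδ.ne')))).exists
  filter_upwards [hD] with i hi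
  calc P {ω | ε ≤ edist (f i ω) (J ω)}
      ≤ P ({ω | ε / 2 ≤ edist (f i ω) (f (x n) ω)} ∪ {ω | ε / 2 ≤ edist (f (x n) ω) (J ω)}) := by
        refine measure_mono fun ω hω => ?_
        by_contra hcon
        simp only [Set.mem_union, Set.mem_ofPred_eq, not_or, not_le] at hcon hω
        have := (edist_triangle (f i ω) (f (x n) ω) (J ω)).trans_lt
          (ENNReal.add_lt_add hcon.1 hcon.2)
        rw [ENNReal.add_halves] at this
        exact absurd hω (not_le.2 this)
    _ ≤ δ / 2 + δ / 2 := (measure_union_le _ _).trans (add_le_add (hDP _ hi _ hn1) hn2)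
    _ = δ := ENNReal.add_halves δ

/-! ### The semigroup extended to `U`. -/

theorem boundedExtension_comp {H U : Type*} [NormedAddCommGroup H] [NormedSpace ℝ H]
    [NormedAddCommGroup U] [NormedSpace ℝ U] {S : ℝ≥0 → H →L[ℝ] H} (hS : IsC0Semigroup S)
    {j : H →L[ℝ] U} (hj : DenseRange j)
    (hext : ∀ t : ℝ≥0, 0 < t → t ≤ 1 → ∃ T : U →L[ℝ] H, T.comp j = S t) {t : ℝ≥0} (ht : 0 < t) :
    (boundedExtension j (S t)).comp j = S t := by
  obtain h1 | h1 := le_total t 1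
  · obtain ⟨T, hT⟩ := hext t ht h1
    rw [boundedExtension_eq hj hT, hT]
  · obtain ⟨T, hT⟩ := hext 1 one_pos le_rfl
    have h2 : ((S (t - 1)).comp T).comp j = S t := by
      rw [ContinuousLinearMap.comp_assoc, hT, ← hS.add, tsub_add_cancel_of_le h1]
    rw [boundedExtension_eq hj h2, h2]

/-- Positivity of `b` matters: the identity `S 0` need not extend to `U`, and then
`boundedExtension` takes its default value `0`. -/
theorem boundedExtension_add {H U : Type*} [NormedAddCommGroup H] [NormedSpace ℝ H]
    [NormedAddCommGroup U] [NormedSpace ℝ U] {S : ℝ≥0 → H →L[ℝ] H} (hS : IsC0Semigroup S)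
    {j : H →L[ℝ] U} (hj : DenseRange j)
    (hext : ∀ t : ℝ≥0, 0 < t → t ≤ 1 → ∃ T : U →L[ℝ] H, T.comp j = S t) (a : ℝ≥0) {b : ℝ≥0}
    (hb : 0 < b) :
    boundedExtension j (S (a + b)) = (S a).comp (boundedExtension j (S b)) := by
  apply boundedExtension_eq hj
  rw [ContinuousLinearMap.comp_assoc, boundedExtension_comp hS hj hext hb, hS.add]

theorem IsC0Semigroup.exists_norm_le {H : Type*} [NormedAddCommGroup H] [NormedSpace ℝ H]
    [CompleteSpace H] {S : ℝ≥0 → H →L[ℝ] H} (hS : IsC0Semigroup S) (T : ℝ≥0) :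
    ∃ M : ℝ, ∀ t ≤ T, ‖S t‖ ≤ M := by
  obtain ⟨M, hM⟩ := banach_steinhaus (g := fun t : Set.Icc (0 : ℝ≥0) T => S t) fun x => by
    obtain ⟨C, hC⟩ := (isCompact_Icc (a := (0 : ℝ≥0)) (b := T)).exists_bound_of_continuousOn
      (hS.continuous x).continuousOn
    exact ⟨C, fun t => hC t t.2⟩
  exact ⟨M, fun t ht => hM ⟨t, zero_le, ht⟩⟩

/-! ### Partitions: reversal, restriction and mesh. -/

namespace TimePartition

theorem mesh_le_iff {t : ℝ≥0} {π : TimePartition t} {δ : ℝ≥0} :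
    π.mesh ≤ δ ↔ ∀ i < π.n, π.pt (i + 1) - π.pt i ≤ δ := by
  simp [mesh, Finset.sup_le_iff]

theorem sub_le_mesh {t : ℝ≥0} (π : TimePartition t) {i : ℕ} (hi : i < π.n) :
    π.pt (i + 1) - π.pt i ≤ π.mesh :=
  mesh_le_iff.1 le_rfl i hi

theorem pt_le {t : ℝ≥0} (π : TimePartition t) {i : ℕ} (hi : i ≤ π.n) : π.pt i ≤ t :=
  (π.mono hi).trans_eq π.pt_n

/-- The partition of `[0, t]` by the multiples of `δ`. -/
noncomputable def uniform (t : ℝ≥0) {δ : ℝ≥0} (hδ : 0 < δ) : TimePartition t where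
  n := ⌈t / δ⌉₊
  pt i := min (i * δ) t
  mono i k hik := min_le_min_right _ (by gcongr)
  pt_zero := by simp
  pt_n := min_eq_right ((div_le_iff₀ hδ).1 (Nat.le_ceil _))

theorem mesh_uniform_le (t : ℝ≥0) {δ : ℝ≥0} (hδ : 0 < δ) : (uniform t hδ).mesh ≤ δ := by
  refine mesh_le_iff.2 fun i _ => ?_
  simp only [uniform]
  rw [tsub_le_iff_left]
  push_cast
  rw [add_one_mul, ← min_add_add_right]
  exact min_le_min le_rfl le_self_add

/-- The image of a partition of `[0, t]` under the time reversal `s ↦ t - s`. -/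
noncomputable def reverse {t : ℝ≥0} (π : TimePartition t) : TimePartition t where
  n := π.n
  pt i := t - π.pt (π.n - i)
  mono i k hik := tsub_le_tsub_left (π.mono (by lia)) _
  pt_zero := by simp [π.pt_n]
  pt_n := by simp [π.pt_zero]

theorem mesh_reverse_le {t : ℝ≥0} (π : TimePartition t) : π.reverse.mesh ≤ π.mesh := by
  refine mesh_le_iff.2 fun i hi => ?_
  simp only [reverse] at hi ⊢
  have h := π.sub_le_mesh (i := π.n - (i + 1)) (by lia)
  rw [show π.n - (i + 1) + 1 = π.n - i by lia] at h
  refine le_trans ?_ h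
  rw [tsub_le_iff_left, ← add_tsub_assoc_of_le (π.mono (by lia)),
    tsub_add_cancel_of_le (π.pt_le (by lia))]

/-- The part before time `a` of a partition of `[0, a + b]`. -/
noncomputable def before {a b : ℝ≥0} (π : TimePartition (a + b)) : TimePartition a where
  n := π.n
  pt i := min (π.pt i) a
  mono i k hik := min_le_min_right _ (π.mono hik)
  pt_zero := by simp [π.pt_zero]
  pt_n := by simp [π.pt_n]

/-- The part after time `a` of a partition of `[0, a + b]`, shifted to `[0, b]`. -/
noncomputable def after {a b : ℝ≥0} (π : TimePartition (a + b)) : TimePartition b where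
  n := π.n
  pt i := π.pt i - a
  mono i k hik := tsub_le_tsub_right (π.mono hik) _
  pt_zero := by simp [π.pt_zero]
  pt_n := by simp [π.pt_n]

theorem mesh_before_le {a b : ℝ≥0} (π : TimePartition (a + b)) : π.before.mesh ≤ π.mesh := by
  refine mesh_le_iff.2 fun i hi => le_trans ?_ (π.sub_le_mesh hi)
  simp only [before]
  rw [tsub_le_iff_left]
  obtain h | h := le_total (π.pt i) a
  · rw [min_eq_left h, add_tsub_cancel_of_le (π.mono i.le_succ)]
    exact min_le_left _ _
  · rw [min_eq_right h]
    exact (min_le_right _ _).trans le_self_add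

theorem mesh_after_le {a b : ℝ≥0} (π : TimePartition (a + b)) : π.after.mesh ≤ π.mesh := by
  refine mesh_le_iff.2 fun i hi => le_trans ?_ (π.sub_le_mesh hi)
  simp only [after]
  rw [tsub_le_iff_left, tsub_le_iff_left]
  calc π.pt (i + 1) = π.pt i + (π.pt (i + 1) - π.pt i) :=
        (add_tsub_cancel_of_le (π.mono i.le_succ)).symm
    _ ≤ (a + (π.pt i - a)) + (π.pt (i + 1) - π.pt i) := by gcongr; exact le_add_tsub
    _ = _ := add_assoc _ _ _

end TimePartition

theorem tendsto_meshFilter_of_mesh_le {t t' : ℝ≥0} {f : TimePartition t → TimePartition t'}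
    (hf : ∀ π, (f π).mesh ≤ π.mesh) : Tendsto f (meshFilter t) (meshFilter t') :=
  tendsto_comap_iff.2 (tendsto_of_tendsto_of_tendsto_of_le_of_le tendsto_const_nhds
    tendsto_comap (fun _ => zero_le) hf)

instance meshFilter_isCountablyGenerated (t : ℝ≥0) : (meshFilter t).IsCountablyGenerated :=
  inferInstanceAs (comap _ _).IsCountablyGenerated

instance meshFilter_neBot (t : ℝ≥0) : (meshFilter t).NeBot := by
  refine comap_neBot fun s hs => ?_
  obtain ⟨δ, hδ, h⟩ := NNReal.nhds_zero_basis.mem_iff.1 hs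
  exact ⟨TimePartition.uniform t (half_pos hδ),
    h ((TimePartition.mesh_uniform_le t (half_pos hδ)).trans_lt (NNReal.half_lt_self hδ.ne'))⟩

/-! ### Shifts and time reversal of a Lévy process. -/

/-- The process that restarts from `0` at time `a`. -/
def shiftedProcess {Ω U : Type*} [NormedAddCommGroup U] (Y : ℝ≥0 → Ω → U) (a : ℝ≥0) :
    ℝ≥0 → Ω → U :=
  fun u ω => Y (a + u) ω - Y a ω

/-- The process shifted to start at time `a`, then stopped at time `t`. -/
noncomputable def stoppedShift {Ω U : Type*} [NormedAddCommGroup U] (Y : ℝ≥0 → Ω → U)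
    (a t : ℝ≥0) : ℝ≥0 → Ω → U :=
  fun u ω => Y (a + min u t) ω - Y a ω

/-- The process with time reversed on `[0, t]`. -/
noncomputable def reversedProcess {Ω U : Type*} [NormedAddCommGroup U] (Y : ℝ≥0 → Ω → U)
    (t : ℝ≥0) : ℝ≥0 → Ω → U :=
  fun u ω => Y t ω - Y (t - u) ω

section Levy

variable {Ω U : Type*} {m : MeasurableSpace Ω} {P : Measure Ω}
  [NormedAddCommGroup U] [MeasurableSpace U] {Y : ℝ≥0 → Ω → U}

theorem IsLevyProcess.shifted [NormedSpace ℝ U] [BorelSpace U] (hY : IsLevyProcess Y P)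
    (a : ℝ≥0) : IsLevyProcess (shiftedProcess Y a) P where
  start := by simp [shiftedProcess]
  indep := by
    intro n t ht
    have h := hY.indep n (fun i => a + t i) (fun i k hik => by dsimp; gcongr; exact ht hik)
    simpa [shiftedProcess] using h
  stationary s h := by
    have h1 := hY.stationary (a + s) h
    have h2 := hY.stationary a h
    refine IdentDistrib.trans ?_ h2.symm
    simpa [shiftedProcess, add_assoc] using h1
  stochCont t := by
    intro ε hε
    have h := (hY.stochCont (a + t) ε hε).comp
      ((continuous_const.add continuous_id).tendsto t : Tendsto (fun s => a + s) _ _)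
    simpa [shiftedProcess, Function.comp_def] using h

/-- Over `[u, v]` both processes have an increment distributed as `Y (min v t - min u t)`. Truncated
subtraction freezes the reversed process after `t`, so the shifted one has to be stopped there. -/
theorem IsLevyProcess.identDistrib_stoppedShift_reversed [NormedSpace ℝ U] [BorelSpace U]
    [SecondCountableTopology U] [IsProbabilityMeasure P] (hY : IsLevyProcess Y P)
    (hm : ∀ t, Measurable (Y t)) (a t : ℝ≥0) :
    IdentDistrib (fun ω u => stoppedShift Y a t u ω) (fun ω u => reversedProcess Y t u ω) P P := by
  refine HasIndepIncrements.identDistrib_process (fun u => (hm _).sub (hm _))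
    (fun u => (hm _).sub (hm _)) (by simp [stoppedShift]) (by simp [reversedProcess]) ?_ ?_ ?_
  · intro n s hs
    have h := hY.indep n (fun i => a + min (s i) t)
      (fun i k hik => by dsimp; gcongr; exact hs hik)
    simpa [stoppedShift] using h
  · intro n s hs
    -- Reversal makes the times decrease; `Fin.rev` lists them in increasing order and then relabels
    -- the increments.
    have h := (hY.indep n (fun i => t - s i.rev)
      (fun i k hik => tsub_le_tsub_left (hs (Fin.rev_le_rev.2 hik)) _)).precomp
        (Fin.rev_injective (n := n))
    simpa [reversedProcess, Fin.rev_succ, Fin.rev_castSucc] using h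
  · intro u v huv
    have h1 := hY.stationary (a + min u t) (min v t - min u t)
    have h2 := hY.stationary (t - v) (min v t - min u t)
    have e1 : a + min u t + (min v t - min u t) = a + min v t := by
      rw [add_assoc, add_tsub_cancel_of_le (min_le_min_right _ huv)]
    have e2 : t - v + (min v t - min u t) = t - u := by
      obtain h | h := le_total v t
      · rw [min_eq_left h, min_eq_left (huv.trans h), tsub_add_tsub_cancel h huv]
      · rw [min_eq_right h, tsub_eq_zero_of_le h, zero_add]
        obtain h' | h' := le_total u t
        · rw [min_eq_left h']
        · rw [min_eq_right h', tsub_eq_zero_of_le h', tsub_self]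
    rw [e1] at h1
    rw [e2] at h2
    simpa [stoppedShift, reversedProcess] using h1.trans h2.symm

end Levy

/-! ### Convergence in measure. -/

section InMeasure

variable {ι Ω E F : Type*} {m : MeasurableSpace Ω} {P : Measure Ω} [NormedAddCommGroup E]
  [NormedAddCommGroup F] {l : Filter ι}

theorem MeasureTheory.TendstoInMeasure.add_of_norm {f g : ι → Ω → E} {f' g' : Ω → E}
    (hf : TendstoInMeasure P f l f') (hg : TendstoInMeasure P g l g') :
    TendstoInMeasure P (fun i ω => f i ω + g i ω) l (fun ω => f' ω + g' ω) := by
  rw [tendstoInMeasure_iff_norm] at *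
  intro ε hε
  have h := (hf (ε / 2) (half_pos hε)).add (hg (ε / 2) (half_pos hε))
  rw [add_zero] at h
  refine tendsto_of_tendsto_of_tendsto_of_le_of_le tendsto_const_nhds h (fun _ => zero_le)
    fun i => (measure_mono fun ω hω => ?_).trans (measure_union_le _ _)
  by_contra hcon
  simp only [Set.mem_union, Set.mem_ofPred_eq, not_or, not_le] at hcon hω
  have := norm_add_le (f i ω - f' ω) (g i ω - g' ω)
  rw [sub_add_sub_comm] at this
  linarith

theorem MeasureTheory.TendstoInMeasure.clm_apply [NormedSpace ℝ E] [NormedSpace ℝ F] {f : ι → Ω → E} {f' : Ω → E}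
    (hf : TendstoInMeasure P f l f') (L : E →L[ℝ] F) :
    TendstoInMeasure P (fun i ω => L (f i ω)) l (fun ω => L (f' ω)) := by
  rw [tendstoInMeasure_iff_norm] at *
  intro ε hε
  have hL : 0 < ‖L‖ + 1 := by positivity
  refine tendsto_of_tendsto_of_tendsto_of_le_of_le tendsto_const_nhds (hf (ε / (‖L‖ + 1))
    (by positivity)) (fun _ => zero_le) fun i => measure_mono fun ω hω => ?_
  simp only [Set.mem_ofPred_eq] at hω ⊢
  rw [div_le_iff₀ hL]
  rw [← map_sub] at hω
  nlinarith [L.le_opNorm (f i ω - f' ω), norm_nonneg (f i ω - f' ω)]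

theorem MeasureTheory.TendstoInMeasure.cauchy {f : ι → Ω → E} {f' : Ω → E} (hf : TendstoInMeasure P f l f')
    {ε : ℝ≥0∞} (hε : 0 < ε) :
    Tendsto (fun q : ι × ι => P {ω | ε ≤ edist (f q.1 ω) (f q.2 ω)}) (l ×ˢ l) (𝓝 0) := by
  have h := ((hf (ε / 2) (ENNReal.half_pos hε.ne')).comp tendsto_fst).add
    ((hf (ε / 2) (ENNReal.half_pos hε.ne')).comp (tendsto_snd (f := l) (g := l)))
  rw [add_zero] at h
  refine tendsto_of_tendsto_of_tendsto_of_le_of_le tendsto_const_nhds h (fun _ => zero_le)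
    fun q => (measure_mono fun ω hω => ?_).trans (measure_union_le _ _)
  by_contra hcon
  simp only [Set.mem_union, Set.mem_ofPred_eq, not_or, not_le] at hcon hω
  have := (edist_triangle_right (f q.1 ω) (f q.2 ω) (f' ω)).trans_lt
    (ENNReal.add_lt_add hcon.1 hcon.2)
  rw [ENNReal.add_halves] at this
  exact absurd hω (not_le.2 this)

end InMeasure

/-! ### Convolution and integral compared by time reversal. -/

section Convolution

variable {Ω U H : Type*} {m : MeasurableSpace Ω} {P : Measure Ω}
  [NormedAddCommGroup U] [NormedSpace ℝ U] [MeasurableSpace U] [BorelSpace U]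
  [SecondCountableTopology U] [NormedAddCommGroup H] [NormedSpace ℝ H]
  [SecondCountableTopology H] {Φ : ℝ≥0 → U →L[ℝ] H}

theorem measurable_stieltjesSum [MeasurableSpace H] [BorelSpace H] {Y : ℝ≥0 → Ω → U} {t : ℝ≥0}
    (π : TimePartition t) (ξ : ℕ → ℝ≥0)
    (hY : ∀ i ≤ π.n, Measurable (Y (π.pt i))) : Measurable (stieltjesSum Φ Y π ξ) := by
  unfold stieltjesSum
  refine Finset.measurable_sum _ fun i hi => (Φ (ξ i)).continuous.measurable.comp ?_
  have := Finset.mem_range.1 hi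
  exact (hY _ (by lia)).sub (hY _ (by lia))

theorem aestronglyMeasurable_stieltjesSum {Y : ℝ≥0 → Ω → U} (hY : ∀ s, Measurable (Y s))
    {t : ℝ≥0} (π : TimePartition t) (ξ : ℕ → ℝ≥0) :
    AEStronglyMeasurable (stieltjesSum Φ Y π ξ) P := by
  borelize H
  exact (measurable_stieltjesSum π ξ fun _ _ => hY _).aestronglyMeasurable

/-- Stieltjes sums are measurable functionals of the path, so the Cauchy property passes between
processes of equal law, although the limits are different random variables. -/
theorem IsStochConvolution.exists_of_identDistrib [IsProbabilityMeasure P] [CompleteSpace H]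
    {X X' : ℝ≥0 → Ω → U} (hX : ∀ s, Measurable (X s))
    (h : IdentDistrib (fun ω u => X u ω) (fun ω u => X' u ω) P P) {t : ℝ≥0} {J' : Ω → H}
    (hJ' : IsStochConvolution P Φ X' t J') : ∃ J : Ω → H, IsStochConvolution P Φ X t J := by
  borelize H
  refine exists_tendstoInMeasure_of_cauchy (fun π => aestronglyMeasurable_stieltjesSum hX _ _)
    fun ε hε => (TendstoInMeasure.cauchy hJ'.2 hε).congr fun q => ?_
  let G : TimePartition t → (ℝ≥0 → U) → H := fun π y =>
    stieltjesSum (fun s => Φ (t - s)) (fun u y => y u) π π.pt y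
  have hG : ∀ π, Measurable (G π) := fun π =>
    measurable_stieltjesSum π _ fun _ _ => measurable_pi_apply _
  exact (h.measure_mem_eq (s := {y | ε ≤ edist (G q.1 y) (G q.2 y)})
    (measurableSet_le measurable_const ((hG _).edist (hG _)))).symm

theorem IsStochConvolution.identDistrib [IsProbabilityMeasure P] [MeasurableSpace H]
    [BorelSpace H] {X X' : ℝ≥0 → Ω → U} (hX : ∀ s, Measurable (X s))
    (hX' : ∀ s, Measurable (X' s))
    (h : IdentDistrib (fun ω u => X u ω) (fun ω u => X' u ω) P P) {t : ℝ≥0} {J J' : Ω → H}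
    (hJ : IsStochConvolution P Φ X t J) (hJ' : IsStochConvolution P Φ X' t J') :
    IdentDistrib J J' P P := by
  refine ⟨hJ.1.aemeasurable, hJ'.1.aemeasurable, ?_⟩
  have d := hJ.2.tendstoInDistribution
    fun π => (measurable_stieltjesSum π _ fun _ _ => hX _).aemeasurable
  have d' := hJ'.2.tendstoInDistribution
    fun π => (measurable_stieltjesSum π _ fun _ _ => hX' _).aemeasurable
  refine tendstoInDistribution_unique _ d ⟨d.forall_aemeasurable, d'.aemeasurable_limit, ?_⟩
  refine d'.tendsto.congr fun π => ?_
  refine Subtype.ext ?_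
  let G : (ℝ≥0 → U) → H := fun y => stieltjesSum (fun s => Φ (t - s)) (fun u y => y u) π π.pt y
  exact (h.comp (u := G) (measurable_stieltjesSum π _ fun _ _ => measurable_pi_apply _)).map_eq.symm

-- A pathwise identity of sums: reversing the partition exchanges left and right endpoints.
omit [MeasurableSpace U] [BorelSpace U] [SecondCountableTopology U] in
omit [SecondCountableTopology H] in
theorem IsStochIntegral.isStochConvolution_reversed {Y : ℝ≥0 → Ω → U} {t : ℝ≥0} {I : Ω → H}
    (hI : IsStochIntegral P Φ Y t I) :
    IsStochConvolution P Φ (reversedProcess Y t) t I := by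
  refine ⟨hI.1, ?_⟩
  refine (hI.2.comp (tendsto_meshFilter_of_mesh_le TimePartition.mesh_reverse_le)).congr_left
    fun π => Eventually.of_forall fun ω => ?_
  simp only [Function.comp_apply, stieltjesSum, reversedProcess, TimePartition.reverse]
  rw [← Finset.sum_range_reflect]
  refine Finset.sum_congr rfl fun i hi => ?_
  have hi := Finset.mem_range.1 hi
  rw [show π.n - (π.n - 1 - i + 1) = i by lia, show π.n - (π.n - 1 - i) = i + 1 by lia]
  simp

omit [MeasurableSpace U] [BorelSpace U] [SecondCountableTopology U] in
omit [SecondCountableTopology H] in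
theorem isStochConvolution_stoppedShift_iff {Y : ℝ≥0 → Ω → U} {a t : ℝ≥0} {J : Ω → H} :
    IsStochConvolution P Φ (stoppedShift Y a t) t J ↔
      IsStochConvolution P Φ (shiftedProcess Y a) t J := by
  refine and_congr_right fun _ => ?_
  refine iff_of_eq ?_
  congr 1
  funext π ω
  refine Finset.sum_congr rfl fun i hi => ?_
  have hi := Finset.mem_range.1 hi
  simp only [stoppedShift, shiftedProcess]
  rw [min_eq_left (π.pt_le hi), min_eq_left (π.pt_le hi.le)]

variable [IsProbabilityMeasure P] {Y : ℝ≥0 → Ω → U}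

theorem IsLevyProcess.exists_convolution_of_integral [CompleteSpace H] (hY : IsLevyProcess Y P)
    (hm : ∀ s, Measurable (Y s)) {t : ℝ≥0} {I : Ω → H} (hI : IsStochIntegral P Φ Y t I)
    (a : ℝ≥0) : ∃ J : Ω → H, IsStochConvolution P Φ (shiftedProcess Y a) t J := by
  obtain ⟨J, hJ⟩ := hI.isStochConvolution_reversed.exists_of_identDistrib
    (X := stoppedShift Y a t) (fun _ => (hm _).sub (hm _))
    (hY.identDistrib_stoppedShift_reversed hm a t)
  exact ⟨J, isStochConvolution_stoppedShift_iff.1 hJ⟩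

theorem IsLevyProcess.identDistrib_convolution_integral [MeasurableSpace H] [BorelSpace H]
    (hY : IsLevyProcess Y P) (hm : ∀ s, Measurable (Y s)) {a t : ℝ≥0} {I J : Ω → H}
    (hJ : IsStochConvolution P Φ (shiftedProcess Y a) t J) (hI : IsStochIntegral P Φ Y t I) :
    IdentDistrib J I P P :=
  (isStochConvolution_stoppedShift_iff.2 hJ).identDistrib (fun _ => (hm _).sub (hm _))
    (fun _ => (hm _).sub (hm _)) (hY.identDistrib_stoppedShift_reversed hm a t)
    hI.isStochConvolution_reversed

theorem IsLevyProcess.identDistrib_convolution_shifted [MeasurableSpace H] [BorelSpace H]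
    (hY : IsLevyProcess Y P) (hm : ∀ s, Measurable (Y s)) {a a' t : ℝ≥0} {J J' : Ω → H}
    (hJ : IsStochConvolution P Φ (shiftedProcess Y a) t J)
    (hJ' : IsStochConvolution P Φ (shiftedProcess Y a') t J') : IdentDistrib J J' P P :=
  (isStochConvolution_stoppedShift_iff.2 hJ).identDistrib (fun _ => (hm _).sub (hm _))
    (fun _ => (hm _).sub (hm _))
    ((hY.identDistrib_stoppedShift_reversed hm a t).trans
      (hY.identDistrib_stoppedShift_reversed hm a' t).symm)
    (isStochConvolution_stoppedShift_iff.2 hJ')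

end Convolution

theorem isStochConvolution_shiftedProcess_zero_iff {Ω U H : Type*} {m : MeasurableSpace Ω}
    {P : Measure Ω} [NormedAddCommGroup U] [NormedSpace ℝ U] [NormedAddCommGroup H]
    [NormedSpace ℝ H] {Φ : ℝ≥0 → U →L[ℝ] H} {Y : ℝ≥0 → Ω → U} {t : ℝ≥0} {J : Ω → H} :
    IsStochConvolution P Φ (shiftedProcess Y 0) t J ↔ IsStochConvolution P Φ Y t J := by
  unfold IsStochConvolution stieltjesSum shiftedProcess
  simp

theorem shiftedProcess_shiftedProcess {Ω U : Type*} [NormedAddCommGroup U] (Y : ℝ≥0 → Ω → U)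
    (c a : ℝ≥0) : shiftedProcess (shiftedProcess Y c) a = shiftedProcess Y (c + a) := by
  funext u ω
  simp [shiftedProcess, add_assoc]

theorem isStochConvolution_zero_time {Ω U H : Type*} {m : MeasurableSpace Ω}
    {P : Measure Ω} [NormedAddCommGroup U] [NormedSpace ℝ U] [NormedAddCommGroup H]
    [NormedSpace ℝ H] (Φ : ℝ≥0 → U →L[ℝ] H) (Y : ℝ≥0 → Ω → U) :
    IsStochConvolution P Φ Y 0 0 := by
  refine ⟨aestronglyMeasurable_zero, ?_⟩
  have h : ∀ π : TimePartition 0, stieltjesSum (fun s => Φ (0 - s)) Y π π.pt = 0 := by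
    intro π
    funext ω
    refine Finset.sum_eq_zero fun i hi => ?_
    have hi := Finset.mem_range.1 hi
    rw [nonpos_iff_eq_zero.1 (π.pt_le hi.le), nonpos_iff_eq_zero.1 (π.pt_le hi), sub_self, map_zero]
  have h0 : TendstoInMeasure P (fun (_ : TimePartition 0) (_ : Ω) => (0 : H)) (meshFilter 0) 0 := by
    intro ε hε
    simp [hε.not_ge]
  exact h0.congr_left fun π => by rw [h]; rfl

/-! ### The flow property. -/

section Splitting

variable {Ω U H : Type*} {m : MeasurableSpace Ω} {P : Measure Ω}
  [NormedAddCommGroup U] [NormedSpace ℝ U] [NormedAddCommGroup H] [NormedSpace ℝ H]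
  {Φ : ℝ≥0 → U →L[ℝ] H} {S : ℝ≥0 → H →L[ℝ] H} {Y : ℝ≥0 → Ω → U} {a b : ℝ≥0}

/-- The error made in a Stieltjes sum over `[0, a + b]` when `a` is inserted into the partition. -/
noncomputable def splittingError (Φ : ℝ≥0 → U →L[ℝ] H) (Y : ℝ≥0 → Ω → U) {a b : ℝ≥0}
    (π : TimePartition (a + b)) (i : ℕ) (ω : Ω) : H :=
  (Φ (a + b - π.pt i) - Φ (a + b - max (π.pt i) a))
    (Y (max (π.pt (i + 1)) a) ω - Y (max (π.pt i) a) ω)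

theorem splittingError_eq_zero (π : TimePartition (a + b)) {i : ℕ}
    (h : π.pt (i + 1) ≤ a ∨ a ≤ π.pt i) (ω : Ω) : splittingError Φ Y π i ω = 0 := by
  obtain h | h := h
  · simp [splittingError, max_eq_right h, max_eq_right ((π.mono i.le_succ).trans h)]
  · simp [splittingError, max_eq_left h]

theorem stieltjesSum_split (hΦ : ∀ s t, 0 < t → Φ (s + t) = (S s).comp (Φ t))
    (π : TimePartition (a + b)) (ω : Ω) :
    stieltjesSum (fun s => Φ (a + b - s)) Y π π.pt ω =
      (S b (stieltjesSum (fun s => Φ (a - s)) Y π.before π.before.pt ω) +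
      stieltjesSum (fun s => Φ (b - s)) (shiftedProcess Y a) π.after π.after.pt ω) +
      ∑ i ∈ Finset.range π.n, splittingError Φ Y π i ω := by
  -- The three partitions share their indices, degenerate intervals contributing zero, so the
  -- identity is checked term by term.
  simp only [stieltjesSum, TimePartition.before, TimePartition.after, map_sum, shiftedProcess]
  rw [← Finset.sum_add_distrib, ← Finset.sum_add_distrib]
  refine Finset.sum_congr rfl fun i _ => ?_
  have hm : π.pt i ≤ π.pt (i + 1) := π.mono i.le_succ
  obtain h | h := le_or_gt a (π.pt i)
  · have e : b - (π.pt i - a) = a + b - π.pt i := by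
      rw [← add_tsub_add_eq_tsub_left a, add_tsub_cancel_of_le h]
    rw [splittingError_eq_zero π (Or.inr h), min_eq_right h, min_eq_right (h.trans hm),
      add_tsub_cancel_of_le h, add_tsub_cancel_of_le (h.trans hm), e]
    simp
  · have e : a + b - π.pt i = b + (a - π.pt i) := by
      refine tsub_eq_of_eq_add ?_
      rw [add_assoc, tsub_add_cancel_of_le h.le]
      exact add_comm a b
    have hs : Φ (a + b - π.pt i) = (S b).comp (Φ (a - π.pt i)) := by
      rw [e, hΦ _ _ (tsub_pos_of_lt h)]
    obtain h' | h' := le_total (π.pt (i + 1)) a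
    · rw [splittingError_eq_zero π (Or.inl h'), min_eq_left h.le, min_eq_left h', hs,
        tsub_eq_zero_of_le h.le, tsub_eq_zero_of_le h']
      simp
    · rw [splittingError, max_eq_left h', max_eq_right h.le, min_eq_left h.le, min_eq_right h',
        tsub_eq_zero_of_le h.le, add_tsub_cancel_of_le h', add_tsub_cancel_left, hs]
      simp only [tsub_zero, add_zero, ContinuousLinearMap.comp_apply,
        sub_self, sub_apply, map_sub, sub_zero]
      abel

/-- At most one interval straddles `a`. There `Φ` is evaluated only in `[b, b + 1]`, away from its
singularity at `0` when `b > 0`, while the increment of `Y` from `a` is small in probability. -/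
theorem tendstoInMeasure_sum_splittingError {M : ℝ} (hM : ∀ s ≤ 1, ‖Φ (s + b)‖ ≤ M)
    (hc : TendstoInMeasure P Y (𝓝 a) (Y a)) :
    TendstoInMeasure P (fun (π : TimePartition (a + b)) ω =>
      ∑ i ∈ Finset.range π.n, splittingError Φ Y π i ω) (meshFilter (a + b)) (fun _ => 0) := by
  have hM0 : 0 ≤ M := (norm_nonneg _).trans (hM 0 zero_le_one)
  rw [tendstoInMeasure_iff_norm] at *
  intro ε hε
  have hε' : 0 < ε / (2 * M + 1) := by positivity
  rw [ENNReal.tendsto_nhds_zero]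
  intro η hη
  have h1 := (hc _ hε').eventually (Iic_mem_nhds hη)
  obtain ⟨δ, hδ, h2⟩ := Metric.eventually_nhds_iff.1 h1
  have h3 : ∀ᶠ π : TimePartition (a + b) in meshFilter (a + b), π.mesh < min 1 ⟨δ, hδ.le⟩ :=
    
    (tendsto_comap (f := TimePartition.mesh)).eventually
      (Iio_mem_nhds (lt_min one_pos (show (0 : ℝ≥0) < ⟨δ, hδ.le⟩ from hδ)))
  filter_upwards [h3] with π hπ
  by_cases hex : ∃ i < π.n, π.pt i < a ∧ a < π.pt (i + 1)
  · obtain ⟨i, hi, hia, hai⟩ := hex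
    have hmesh := (π.sub_le_mesh hi).trans_lt hπ
    have hd : dist (π.pt (i + 1)) a < δ := by
      rw [NNReal.dist_eq, abs_of_nonneg (sub_nonneg.2 (NNReal.coe_le_coe.2 hai.le)),
        ← NNReal.coe_sub hai.le]
      exact (NNReal.coe_le_coe.2 (tsub_le_tsub_left hia.le _)).trans_lt
        (NNReal.coe_lt_coe.2 (hmesh.trans_le (min_le_right _ _)))
    refine (measure_mono fun ω hω => ?_).trans (h2 hd)
    simp only [Set.mem_ofPred_eq, sub_zero] at hω ⊢
    rw [Finset.sum_eq_single i, splittingError, max_eq_left hai.le, max_eq_right hia.le] at hω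
    · have e : a + b - π.pt i = (a - π.pt i) + b := tsub_add_eq_add_tsub hia.le |>.symm
      rw [e, add_tsub_cancel_left] at hω
      have n1 : ‖Φ ((a - π.pt i) + b) - Φ b‖ ≤ 2 * M := by
        refine (norm_sub_le _ _).trans ?_
        have := hM (a - π.pt i) ((tsub_le_tsub_right hai.le _).trans
          (hmesh.le.trans (min_le_left _ _)))
        have h0 := hM 0 zero_le_one
        rw [zero_add] at h0
        linarith
      have n2 := (Φ ((a - π.pt i) + b) - Φ b).le_of_opNorm_le n1 (Y (π.pt (i + 1)) ω - Y a ω)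
      rw [div_le_iff₀ (by positivity)]
      nlinarith [norm_nonneg (Y (π.pt (i + 1)) ω - Y a ω)]
    · intro k _ hk
      refine splittingError_eq_zero π ?_ ω
      obtain h | h := lt_or_gt_of_ne hk
      · exact Or.inl ((π.mono h).trans hia.le)
      · exact Or.inr (hai.le.trans (π.mono h))
    · exact fun h => absurd (Finset.mem_range.2 hi) h
  · push Not at hex
    have h0 : ∀ ω, ∑ i ∈ Finset.range π.n, splittingError Φ Y π i ω = 0 := fun ω =>
      Finset.sum_eq_zero fun i hi => splittingError_eq_zero π (by
        obtain h | h := le_or_gt a (π.pt i)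
        · exact Or.inr h
        · exact Or.inl (hex i (Finset.mem_range.1 hi) h)) ω
    simp [h0, hε.not_ge]

theorem IsStochConvolution.add_time (hΦ : ∀ s t, 0 < t → Φ (s + t) = (S s).comp (Φ t))
    {M : ℝ} (hM : ∀ s ≤ 1, ‖S s‖ ≤ M) (hb : 0 < b)
    (hc : TendstoInMeasure P Y (𝓝 a) (Y a)) {J J' : Ω → H}
    (hJ : IsStochConvolution P Φ Y a J) (hJ' : IsStochConvolution P Φ (shiftedProcess Y a) b J') :
    IsStochConvolution P Φ Y (a + b) (fun ω => S b (J ω) + J' ω) := by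
  refine ⟨((S b).continuous.comp_aestronglyMeasurable hJ.1).add hJ'.1, ?_⟩
  have h1 := TendstoInMeasure.clm_apply (hJ.2.comp
    (tendsto_meshFilter_of_mesh_le (TimePartition.mesh_before_le (a := a) (b := b)))) (S b)
  have h2 := hJ'.2.comp
    (tendsto_meshFilter_of_mesh_le (TimePartition.mesh_after_le (a := a) (b := b)))
  have h3 : TendstoInMeasure P (fun (π : TimePartition (a + b)) ω =>
      ∑ i ∈ Finset.range π.n, splittingError Φ Y π i ω) (meshFilter (a + b)) (fun _ => 0) := by
    refine tendstoInMeasure_sum_splittingError (M := M * ‖Φ b‖) (fun s hs => ?_) hc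
    rw [hΦ s b hb]
    exact (ContinuousLinearMap.opNorm_comp_le _ _).trans
      (mul_le_mul_of_nonneg_right (hM s hs) (norm_nonneg _))
  have h4 := (h1.add_of_norm h2).add_of_norm h3
  simp only [add_zero] at h4
  exact h4.congr_left fun π => Eventually.of_forall fun ω => (stieltjesSum_split hΦ π ω).symm

end Splitting

/-! ### Moments of the convolution. -/

section Moments

variable {Ω E F : Type*} {m : MeasurableSpace Ω} {P : Measure Ω} [NormedAddCommGroup E]
  [NormedAddCommGroup F] {p : ℝ}

/-- Bounding `a + b` by `2 * max a b` treats `p < 1` and `p ≥ 1` together. -/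
theorem ENNReal.add_rpow_le_two_rpow_mul (a b : ℝ≥0∞) (hp : 0 ≤ p) :
    (a + b) ^ p ≤ 2 ^ p * (a ^ p + b ^ p) := by
  have h : a + b ≤ 2 * max a b := by
    rw [two_mul]
    exact add_le_add (le_max_left _ _) (le_max_right _ _)
  refine (ENNReal.rpow_le_rpow h hp).trans ?_
  rw [ENNReal.mul_rpow_of_nonneg _ _ hp]
  gcongr
  obtain h | h := le_total a b
  · rw [max_eq_right h]; exact le_add_self
  · rw [max_eq_left h]; exact le_self_add

theorem lintegral_enorm_add_rpow_le (hp : 0 ≤ p) {f : Ω → E} (hf : AEStronglyMeasurable f P)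
    (g : Ω → E) :
    ∫⁻ ω, ‖f ω + g ω‖ₑ ^ p ∂P ≤ 2 ^ p * (∫⁻ ω, ‖f ω‖ₑ ^ p ∂P + ∫⁻ ω, ‖g ω‖ₑ ^ p ∂P) := by
  rw [← lintegral_add_left' (hf.enorm.pow_const p), ← lintegral_const_mul' _ _ (by simp)]
  exact lintegral_mono fun ω => (ENNReal.rpow_le_rpow (enorm_add_le _ _) hp).trans
    (ENNReal.add_rpow_le_two_rpow_mul _ _ hp)

theorem lintegral_enorm_clm_rpow_le [NormedSpace ℝ E] [NormedSpace ℝ F] (hp : 0 ≤ p)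
    (L : E →L[ℝ] F) (f : Ω → E) {M : ℝ≥0} (hM : ‖L‖ ≤ M) :
    ∫⁻ ω, ‖L (f ω)‖ₑ ^ p ∂P ≤ (M : ℝ≥0∞) ^ p * ∫⁻ ω, ‖f ω‖ₑ ^ p ∂P := by
  rw [← lintegral_const_mul' _ _ (by simp [hp])]
  refine lintegral_mono fun ω => ?_
  dsimp only
  rw [← ENNReal.mul_rpow_of_nonneg _ _ hp]
  refine ENNReal.rpow_le_rpow ?_ hp
  rw [enorm_eq_nnnorm, enorm_eq_nnnorm, ← ENNReal.coe_mul, ENNReal.coe_le_coe]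
  exact L.le_of_opNorm_le hM _

theorem IdentDistrib.lintegral_enorm_rpow_eq [NormedSpace ℝ E] [NormedSpace ℝ F]
    [MeasurableSpace E] [BorelSpace E] {f g : Ω → E} (h : IdentDistrib f g P P)
    (L : E →L[ℝ] F) : ∫⁻ ω, ‖L (f ω)‖ₑ ^ p ∂P = ∫⁻ ω, ‖L (g ω)‖ₑ ^ p ∂P :=
  (h.comp (u := fun x => ‖L x‖ₑ ^ p)
    (L.continuous.enorm.measurable.pow_const p)).lintegral_eq

end Moments

/-- Bounds for the `p`-th moment of the stochastic convolution after `k + 1` steps of equal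
length, when the semigroup has norm at most `M` over one step. -/
noncomputable def momentConst (p : ℝ) (M : ℝ≥0) : ℕ → ℝ≥0
  | 0 => 1
  | k + 1 => 2 ^ p * (M ^ p * momentConst p M k + 1)

section Convolution

variable {Ω U H : Type*} {m : MeasurableSpace Ω} {P : Measure Ω} [IsProbabilityMeasure P]
  [NormedAddCommGroup U] [NormedSpace ℝ U] [MeasurableSpace U] [BorelSpace U]
  [SecondCountableTopology U] [NormedAddCommGroup H] [NormedSpace ℝ H] [CompleteSpace H]
  [SecondCountableTopology H] {Φ : ℝ≥0 → U →L[ℝ] H} {S : ℝ≥0 → H →L[ℝ] H} {Y : ℝ≥0 → Ω → U}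
  {I : ℝ≥0 → Ω → H} {p : ℝ}

omit [IsProbabilityMeasure P] [MeasurableSpace U] [BorelSpace U] [SecondCountableTopology U]
  [CompleteSpace H] [SecondCountableTopology H] in
theorem IsStochConvolution.ae_eq {t : ℝ≥0} {J J' : Ω → H} (hJ : IsStochConvolution P Φ Y t J)
    (hJ' : IsStochConvolution P Φ Y t J') : J =ᵐ[P] J' :=
  tendstoInMeasure_ae_unique hJ.2 hJ'.2

omit [IsProbabilityMeasure P] [SecondCountableTopology U] [SecondCountableTopology H] in
theorem IsLevyProcess.convolution_add_time (hS : IsC0Semigroup S)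
    (hΦ : ∀ s t, 0 < t → Φ (s + t) = (S s).comp (Φ t)) (hY : IsLevyProcess Y P) {a b c : ℝ≥0}
    (hb : 0 < b) {J J' : Ω → H} (hJ : IsStochConvolution P Φ (shiftedProcess Y c) a J)
    (hJ' : IsStochConvolution P Φ (shiftedProcess Y (c + a)) b J') :
    IsStochConvolution P Φ (shiftedProcess Y c) (a + b) (fun ω => S b (J ω) + J' ω) := by
  obtain ⟨M, hM⟩ := hS.exists_norm_le 1
  rw [← shiftedProcess_shiftedProcess] at hJ'
  exact hJ.add_time hΦ hM hb ((hY.shifted c).stochCont a) hJ'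

theorem IsLevyProcess.exists_convolution (hS : IsC0Semigroup S)
    (hΦ : ∀ s t, 0 < t → Φ (s + t) = (S s).comp (Φ t)) (hY : IsLevyProcess Y P)
    (hm : ∀ s, Measurable (Y s))
    (hI : ∀ t : ℝ≥0, 0 < t → t ≤ 1 → IsStochIntegral P Φ Y t (I t)) (c t : ℝ≥0) :
    ∃ J : Ω → H, IsStochConvolution P Φ (shiftedProcess Y c) t J := by
  obtain rfl | ht := eq_zero_or_pos t
  · exact ⟨0, isStochConvolution_zero_time _ _⟩
  have hn : (0 : ℝ≥0) < ⌈t⌉₊ + 1 := by positivity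
  have hh : 0 < t / (⌈t⌉₊ + 1) := by positivity
  have hh1 : t / (⌈t⌉₊ + 1) ≤ 1 :=
    (div_le_one₀ hn).2 ((Nat.le_ceil t).trans le_self_add)
  have key : ∀ (k : ℕ) (c : ℝ≥0),
      ∃ J : Ω → H, IsStochConvolution P Φ (shiftedProcess Y c) ((k + 1) * (t / (⌈t⌉₊ + 1))) J := by
    intro k
    induction k with
    | zero =>
      intro c
      simpa using hY.exists_convolution_of_integral hm (hI _ hh hh1) c
    | succ k ih =>
      intro c
      obtain ⟨J, hJ⟩ := ih c
      obtain ⟨J', hJ'⟩ := hY.exists_convolution_of_integral hm (hI _ hh hh1)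
        (c + (k + 1) * (t / (⌈t⌉₊ + 1)))
      have h := hY.convolution_add_time hS hΦ hh hJ hJ'
      rw [← add_one_mul] at h
      push_cast
      exact ⟨_, h⟩
  have h := key ⌈t⌉₊ c
  rwa [mul_div_cancel₀ _ hn.ne'] at h

/-- Each further step applies `S h` to the previous convolution and adds a term with the law of `I
h`; this is the recursion of `momentConst`. -/
theorem IsLevyProcess.lintegral_convolution_le (hp : 0 ≤ p) (hS : IsC0Semigroup S)
    (hΦ : ∀ s t, 0 < t → Φ (s + t) = (S s).comp (Φ t)) (hY : IsLevyProcess Y P)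
    (hm : ∀ s, Measurable (Y s))
    (hI : ∀ t : ℝ≥0, 0 < t → t ≤ 1 → IsStochIntegral P Φ Y t (I t)) {γ : ℝ≥0∞}
    (hγ : ∀ t : ℝ≥0, 0 < t → t ≤ 1 → ∫⁻ ω, ‖I t ω‖ₑ ^ p ∂P ≤ γ) {h : ℝ≥0} (h0 : 0 < h)
    (h1 : h ≤ 1) (k : ℕ) {c : ℝ≥0} {J : Ω → H}
    (hJ : IsStochConvolution P Φ (shiftedProcess Y c) ((k + 1) * h) J) :
    ∫⁻ ω, ‖J ω‖ₑ ^ p ∂P ≤ γ * momentConst p ‖S h‖₊ k := by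
  have one : ∀ {c : ℝ≥0} {J : Ω → H}, IsStochConvolution P Φ (shiftedProcess Y c) h J →
      ∫⁻ ω, ‖J ω‖ₑ ^ p ∂P ≤ γ := by
    intro c J hJ
    borelize H
    have e := IdentDistrib.lintegral_enorm_rpow_eq (p := p)
      (hY.identDistrib_convolution_integral hm hJ (hI h h0 h1)) (ContinuousLinearMap.id ℝ H)
    exact e.trans_le (hγ h h0 h1)
  induction k generalizing c J with
  | zero =>
    simp only [Nat.cast_zero, zero_add, one_mul] at hJ
    simpa [momentConst] using one hJ
  | succ k ih =>
    obtain ⟨J₁, hJ₁⟩ := hY.exists_convolution hS hΦ hm hI c ((k + 1) * h)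
    obtain ⟨J₂, hJ₂⟩ := hY.exists_convolution hS hΦ hm hI (c + (k + 1) * h) h
    have hs := hY.convolution_add_time hS hΦ h0 hJ₁ hJ₂
    rw [← add_one_mul] at hs
    push_cast at hJ
    calc ∫⁻ ω, ‖J ω‖ₑ ^ p ∂P = ∫⁻ ω, ‖S h (J₁ ω) + J₂ ω‖ₑ ^ p ∂P := by
          refine lintegral_congr_ae ?_
          filter_upwards [hJ.ae_eq hs] with ω hω
          rw [hω]
      _ ≤ 2 ^ p * (∫⁻ ω, ‖S h (J₁ ω)‖ₑ ^ p ∂P + ∫⁻ ω, ‖J₂ ω‖ₑ ^ p ∂P) :=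
          lintegral_enorm_add_rpow_le hp ((S h).continuous.comp_aestronglyMeasurable hJ₁.1) _
      _ ≤ 2 ^ p * ((‖S h‖₊ : ℝ≥0∞) ^ p * (γ * momentConst p ‖S h‖₊ k) + γ) := by
          gcongr
          · exact (lintegral_enorm_clm_rpow_le hp (S h) J₁ le_rfl).trans (by gcongr; exact ih hJ₁)
          · exact one hJ₂
      _ = γ * momentConst p ‖S h‖₊ (k + 1) := by
          rw [momentConst]
          push_cast [ENNReal.coe_rpow_of_nonneg _ hp]
          ring

end Convolution

/-! ### Continuity in `p`-th mean. -/

theorem IsC0Semigroup.tendsto_lintegral_sub_self {Ω H : Type*} {m : MeasurableSpace Ω}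
    {P : Measure Ω} [NormedAddCommGroup H] [NormedSpace ℝ H] [CompleteSpace H]
    {S : ℝ≥0 → H →L[ℝ] H} (hS : IsC0Semigroup S) {p : ℝ} (hp : 0 < p) {f : Ω → H}
    (hf : AEStronglyMeasurable f P) (hfp : ∫⁻ ω, ‖f ω‖ₑ ^ p ∂P < ∞) :
    Tendsto (fun h => ∫⁻ ω, ‖S h (f ω) - f ω‖ₑ ^ p ∂P) (𝓝 0) (𝓝 0) := by
  obtain ⟨M, hM⟩ := hS.exists_norm_le 1
  have hM' : ∀ h ≤ 1, ‖S h - ContinuousLinearMap.id ℝ H‖ ≤ (M.toNNReal + 1 : ℝ≥0) := fun h hh => by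
    refine (norm_sub_le _ _).trans ?_
    push_cast
    exact add_le_add ((hM h hh).trans (Real.le_coe_toNNReal M)) ContinuousLinearMap.norm_id_le
  have h0 : ∫⁻ _, (0 : ℝ≥0∞) ∂P = 0 := lintegral_zero
  rw [← h0]
  refine tendsto_lintegral_filter_of_dominated_convergence'
    (fun ω => ((M.toNNReal + 1 : ℝ≥0) : ℝ≥0∞) ^ p * ‖f ω‖ₑ ^ p) ?_ ?_ ?_ ?_
  · exact Eventually.of_forall fun h =>
      ((((S h).continuous.comp_aestronglyMeasurable hf).sub hf).enorm.pow_const p)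
  · filter_upwards [Iic_mem_nhds (zero_lt_one' ℝ≥0)] with h hh
    refine Eventually.of_forall fun ω => ?_
    rw [← ENNReal.mul_rpow_of_nonneg _ _ hp.le]
    refine ENNReal.rpow_le_rpow ?_ hp.le
    rw [enorm_eq_nnnorm, enorm_eq_nnnorm, ← ENNReal.coe_mul, ENNReal.coe_le_coe]
    exact (S h - ContinuousLinearMap.id ℝ H).le_of_opNorm_le (hM' h hh) (f ω)
  · rw [lintegral_const_mul' _ _ (by finiteness)]
    finiteness
  · refine Eventually.of_forall fun ω => ?_
    have h1 : Tendsto (fun h => S h (f ω) - f ω) (𝓝 0) (𝓝 0) := by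
      have := ((hS.continuous (f ω)).tendsto 0).sub_const (f ω)
      simpa [hS.zero] using this
    have h2 := (ENNReal.continuous_rpow_const (y := p)).tendsto 0 |>.comp
      (by simpa using h1.enorm : Tendsto (fun h => ‖S h (f ω) - f ω‖ₑ) (𝓝 0) (𝓝 0))
    simpa [Function.comp_def, hp] using h2

section Continuity

variable {Ω U H : Type*} {m : MeasurableSpace Ω} {P : Measure Ω} [IsProbabilityMeasure P]
  [NormedAddCommGroup U] [NormedSpace ℝ U] [MeasurableSpace U] [BorelSpace U]
  [SecondCountableTopology U] [NormedAddCommGroup H] [NormedSpace ℝ H] [CompleteSpace H]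
  [SecondCountableTopology H] {Φ : ℝ≥0 → U →L[ℝ] H} {S : ℝ≥0 → H →L[ℝ] H} {Y : ℝ≥0 → Ω → U}
  {I Z : ℝ≥0 → Ω → H} {p : ℝ}

omit [CompleteSpace H] in
theorem IsLevyProcess.lintegral_convolution_eq (hY : IsLevyProcess Y P)
    (hm : ∀ s, Measurable (Y s)) {h c : ℝ≥0} {K J : Ω → H} (hK : IsStochIntegral P Φ Y h K)
    (hJ : IsStochConvolution P Φ (shiftedProcess Y c) h J) :
    ∫⁻ ω, ‖J ω‖ₑ ^ p ∂P = ∫⁻ ω, ‖K ω‖ₑ ^ p ∂P := by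
  borelize H
  exact IdentDistrib.lintegral_enorm_rpow_eq (p := p)
    (hY.identDistrib_convolution_integral hm hJ hK) (ContinuousLinearMap.id ℝ H)

/-- The increment of the stochastic convolution over `[s, s + h]`. -/
theorem IsLevyProcess.lintegral_convolution_sub_le (hp : 0 ≤ p) (hS : IsC0Semigroup S)
    (hΦ : ∀ s t, 0 < t → Φ (s + t) = (S s).comp (Φ t)) (hY : IsLevyProcess Y P)
    (hm : ∀ s, Measurable (Y s))
    (hI : ∀ t : ℝ≥0, 0 < t → t ≤ 1 → IsStochIntegral P Φ Y t (I t))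
    (hZ : ∀ t, IsStochConvolution P Φ Y t (Z t)) {s h : ℝ≥0} (h0 : 0 < h) (h1 : h ≤ 1) :
    ∫⁻ ω, ‖Z (s + h) ω - Z s ω‖ₑ ^ p ∂P ≤
      2 ^ p * (∫⁻ ω, ‖S h (Z s ω) - Z s ω‖ₑ ^ p ∂P + ∫⁻ ω, ‖I h ω‖ₑ ^ p ∂P) := by
  obtain ⟨J, hJ⟩ := hY.exists_convolution hS hΦ hm hI s h
  have e := (isStochConvolution_shiftedProcess_zero_iff.2 (hZ (s + h))).ae_eq
    (hY.convolution_add_time hS hΦ h0 (isStochConvolution_shiftedProcess_zero_iff.2 (hZ s))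
      ((zero_add s).symm ▸ hJ))
  calc ∫⁻ ω, ‖Z (s + h) ω - Z s ω‖ₑ ^ p ∂P
      = ∫⁻ ω, ‖(S h (Z s ω) - Z s ω) + J ω‖ₑ ^ p ∂P := by
        refine lintegral_congr_ae ?_
        filter_upwards [e] with ω hω
        rw [hω]
        congr 2
        abel
    _ ≤ _ := by
        rw [← hY.lintegral_convolution_eq hm (hI h h0 h1) hJ]
        exact lintegral_enorm_add_rpow_le hp
          (((S h).continuous.comp_aestronglyMeasurable (hZ s).1).sub (hZ s).1) _

/-- By stationarity, `S h - 1` acts on the convolution at time `s` as on that over `[h, s + h]`,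
which is close to the convolution at time `s + h`. -/
theorem IsLevyProcess.lintegral_semigroup_sub_le (hp : 0 ≤ p) (hS : IsC0Semigroup S)
    (hΦ : ∀ s t, 0 < t → Φ (s + t) = (S s).comp (Φ t)) (hY : IsLevyProcess Y P)
    (hm : ∀ s, Measurable (Y s))
    (hI : ∀ t : ℝ≥0, 0 < t → t ≤ 1 → IsStochIntegral P Φ Y t (I t))
    (hZ : ∀ t, IsStochConvolution P Φ Y t (Z t)) {s h : ℝ≥0} (hs : 0 < s) (h0 : 0 < h)
    (h1 : h ≤ 1) {M : ℝ≥0}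
    (hM : ‖(S h - ContinuousLinearMap.id ℝ H).comp (S s)‖ ≤ M) :
    ∫⁻ ω, ‖S h (Z s ω) - Z s ω‖ₑ ^ p ∂P ≤
      2 ^ p * (∫⁻ ω, ‖S h (Z (s + h) ω) - Z (s + h) ω‖ₑ ^ p ∂P +
        M ^ p * ∫⁻ ω, ‖I h ω‖ₑ ^ p ∂P) := by
  borelize H
  have hZ' := fun t => isStochConvolution_shiftedProcess_zero_iff.2 (hZ t)
  obtain ⟨J, hJ⟩ := hY.exists_convolution hS hΦ hm hI h s
  have e := (hZ' (h + s)).ae_eq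
    (hY.convolution_add_time hS hΦ hs (hZ' h) ((zero_add h).symm ▸ hJ))
  have hid := IdentDistrib.lintegral_enorm_rpow_eq (p := p)
    (hY.identDistrib_convolution_shifted hm (hZ' s) hJ) (S h - ContinuousLinearMap.id ℝ H)
  have hsh : AEStronglyMeasurable (fun ω => S h (Z (s + h) ω) - Z (s + h) ω) P :=
    ((S h).continuous.comp_aestronglyMeasurable (hZ _).1).sub (hZ _).1
  -- `J` has the law of `Z s`, and the flow property gives `J = Z (s + h) - S s (Z h)` almost
  -- surely.
  calc ∫⁻ ω, ‖S h (Z s ω) - Z s ω‖ₑ ^ p ∂P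
      = ∫⁻ ω, ‖(S h (Z (s + h) ω) - Z (s + h) ω) +
          ((-(S h - ContinuousLinearMap.id ℝ H).comp (S s)) (Z h ω))‖ₑ ^ p ∂P := by
        refine hid.trans (lintegral_congr_ae ?_)
        filter_upwards [e] with ω hω
        rw [add_comm s h, hω]
        congr 2
        simp only [sub_apply, neg_apply, ContinuousLinearMap.comp_apply, ContinuousLinearMap.id_apply,
          map_add]
        abel
    _ ≤ 2 ^ p * (∫⁻ ω, ‖S h (Z (s + h) ω) - Z (s + h) ω‖ₑ ^ p ∂P +
          M ^ p * ∫⁻ ω, ‖Z h ω‖ₑ ^ p ∂P) := by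
        refine (lintegral_enorm_add_rpow_le hp hsh _).trans ?_
        gcongr
        exact lintegral_enorm_clm_rpow_le hp _ (Z h) (by rwa [norm_neg])
    _ = _ := by rw [hY.lintegral_convolution_eq hm (hI h h0 h1) (hZ' h)]

/-- On both sides the bound involves only `S h - 1` applied to the fixed `Z t`, handled by dominated
convergence, and the moment of `I h`. -/
theorem IsLevyProcess.tendsto_lintegral_convolution (hp : 0 < p) (hS : IsC0Semigroup S)
    (hΦ : ∀ s t, 0 < t → Φ (s + t) = (S s).comp (Φ t)) (hY : IsLevyProcess Y P)
    (hm : ∀ s, Measurable (Y s))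
    (hI : ∀ t : ℝ≥0, 0 < t → t ≤ 1 → IsStochIntegral P Φ Y t (I t))
    (hI0 : Tendsto (fun t => ∫⁻ ω, ‖I t ω‖ₑ ^ p ∂P) (𝓝[>] 0) (𝓝 0))
    (hZ : ∀ t, IsStochConvolution P Φ Y t (Z t)) (hZp : ∀ t, ∫⁻ ω, ‖Z t ω‖ₑ ^ p ∂P < ∞)
    (t : ℝ≥0) :
    Tendsto (fun s => ∫⁻ ω, ‖Z s ω - Z t ω‖ₑ ^ p ∂P) (𝓝 t) (𝓝 0) := by
  obtain ⟨M, hM⟩ := hS.exists_norm_le (t + 1)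
  set N : ℝ≥0 := (M.toNNReal + 1) * M.toNNReal
  have hN : ∀ s h, s ≤ t → h ≤ 1 → ‖(S h - ContinuousLinearMap.id ℝ H).comp (S s)‖ ≤ N := by
    intro s h hs hh
    refine (ContinuousLinearMap.opNorm_comp_le _ _).trans ?_
    have h1 := hM s (hs.trans le_self_add)
    have h2 := hM h (hh.trans le_add_self)
    have h3 := Real.le_coe_toNNReal M
    have h4 : ‖S h - ContinuousLinearMap.id ℝ H‖ ≤ M.toNNReal + 1 :=
      (norm_sub_le _ _).trans (add_le_add (h2.trans h3) ContinuousLinearMap.norm_id_le)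
    push_cast [N]
    exact mul_le_mul h4 (h1.trans h3) (norm_nonneg _) (by positivity)
  set ψ : ℝ≥0 → ℝ≥0∞ := fun h => ∫⁻ ω, ‖S h (Z t ω) - Z t ω‖ₑ ^ p ∂P
  set E : ℝ≥0 → ℝ≥0∞ := fun h => ∫⁻ ω, ‖I h ω‖ₑ ^ p ∂P
  have hψ : Tendsto ψ (𝓝[>] 0) (𝓝 0) :=
    (hS.tendsto_lintegral_sub_self hp (hZ t).1 (hZp t)).mono_left nhdsWithin_le_nhds
  have hr : Tendsto (fun h => 2 ^ p * (ψ h + E h)) (𝓝[>] 0) (𝓝 0) := by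
    have := ENNReal.Tendsto.const_mul (a := 2 ^ p) (hψ.add hI0) (Or.inr (by finiteness))
    simpa using this
  have hl : Tendsto (fun h => 2 ^ p * (2 ^ p * (ψ h + (N : ℝ≥0∞) ^ p * E h) + E h))
      (𝓝[>] 0) (𝓝 0) := by
    have h1 := ENNReal.Tendsto.const_mul (a := (N : ℝ≥0∞) ^ p) hI0 (Or.inr (by finiteness))
    have h2 := ENNReal.Tendsto.const_mul (a := 2 ^ p) (hψ.add h1) (Or.inr (by finiteness))
    have := ENNReal.Tendsto.const_mul (a := 2 ^ p) (h2.add hI0) (Or.inr (by finiteness))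
    simpa using this
  rw [ENNReal.tendsto_nhds_zero] at hr hl ⊢
  intro ε hε
  obtain ⟨δ, hδ, hδε⟩ := (mem_nhdsGT_iff_exists_Ioo_subset).1 ((hr ε hε).and (hl ε hε))
  have hδ' : 0 < min δ 1 := lt_min hδ one_pos
  have n1 : ∀ᶠ s in 𝓝 t, s < t + min δ 1 := Iio_mem_nhds (lt_add_of_pos_right t hδ')
  have n2 : ∀ᶠ s in 𝓝 t, t < s + min δ 1 :=
    ((continuous_id.add continuous_const).tendsto t).eventually
      (Ioi_mem_nhds (lt_add_of_pos_right t hδ'))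
  -- The estimate from the left splits off a last piece of length `s`, which must be positive.
  have n3 : ∀ᶠ s in 𝓝 t, 0 < s ∨ t ≤ s := by
    obtain rfl | ht := eq_zero_or_pos t
    · exact Eventually.of_forall fun s => Or.inr zero_le
    · filter_upwards [Ioi_mem_nhds ht] with s hs using Or.inl hs
  filter_upwards [n1, n2, n3] with s hs1 hs2 hs3
  obtain hst | rfl | hst := lt_trichotomy s t
  · have hh0 : 0 < t - s := tsub_pos_of_lt hst
    have hh := tsub_lt_iff_left hst.le |>.2 hs2
    have hs0 : 0 < s := hs3.resolve_right hst.not_ge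
    have h1 : t - s ≤ 1 := hh.le.trans (min_le_right _ _)
    have e : s + (t - s) = t := add_tsub_cancel_of_le hst.le
    have a1 := hY.lintegral_convolution_sub_le hp.le hS hΦ hm hI hZ (s := s) hh0 h1
    have a2 := hY.lintegral_semigroup_sub_le hp.le hS hΦ hm hI hZ hs0 hh0 h1 (hN s _ hst.le h1)
    rw [e] at a1 a2
    refine le_trans ?_ (hδε ⟨hh0, hh.trans_le (min_le_left _ _)⟩).2
    calc ∫⁻ ω, ‖Z s ω - Z t ω‖ₑ ^ p ∂P = ∫⁻ ω, ‖Z t ω - Z s ω‖ₑ ^ p ∂P := by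
          simp_rw [enorm_sub_rev]
      _ ≤ _ := a1.trans (by gcongr)
  · simp [hp]
  · have hh0 : 0 < s - t := tsub_pos_of_lt hst
    have hh := tsub_lt_iff_left hst.le |>.2 hs1
    have a1 := hY.lintegral_convolution_sub_le hp.le hS hΦ hm hI hZ (s := t) hh0
      (hh.le.trans (min_le_right _ _))
    rw [add_tsub_cancel_of_le hst.le] at a1
    exact a1.trans (hδε ⟨hh0, hh.trans_le (min_le_left _ _)⟩).1

end Continuity

/-! ### Predictable modifications. -/

/-- The last multiple of `δ` strictly before `s` (or `0`). -/
noncomputable def gridPoint (δ s : ℝ≥0) : ℝ≥0 := ((⌈s / δ⌉₊ - 1 : ℕ) : ℝ≥0) * δ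

theorem dist_gridPoint_le {δ : ℝ≥0} (hδ : 0 < δ) (s : ℝ≥0) : dist (gridPoint δ s) s ≤ δ := by
  have h1 : gridPoint δ s ≤ s := by
    obtain h | h := Nat.eq_zero_or_pos (⌈s / δ⌉₊ - 1)
    · simp [gridPoint, h]
    · have := Nat.lt_ceil.1 (show ⌈s / δ⌉₊ - 1 < ⌈s / δ⌉₊ by lia)
      exact ((lt_div_iff₀ hδ).1 this).le
  have h2 : s ≤ gridPoint δ s + δ := by
    have h3 : s ≤ ⌈s / δ⌉₊ * δ := (div_le_iff₀ hδ).1 (Nat.le_ceil _)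
    refine h3.trans ?_
    rw [gridPoint, ← add_one_mul]
    gcongr
    norm_cast
    lia
  rw [dist_comm, NNReal.dist_eq, abs_of_nonneg (sub_nonneg.2 (NNReal.coe_le_coe.2 h1)),
    sub_le_iff_le_add']
  exact_mod_cast h2

section Predictable

variable {Ω E : Type*} {m : MeasurableSpace Ω} {P : Measure Ω} {𝓕 : Filtration ℝ≥0 m}
  [NormedAddCommGroup E] {W : ℝ≥0 → Ω → E}

/-- On `(kδ, (k + 1)δ]` the process equals `W (kδ)`, known at the excluded left end, so preimages
are unions of predictable rectangles. -/
theorem isStronglyPredictable_gridPoint [SecondCountableTopology E]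
    (hW : ∀ t, StronglyMeasurable[𝓕 t] (W t)) {δ : ℝ≥0} (hδ : 0 < δ) :
    IsStronglyPredictable 𝓕 (fun s => W (gridPoint δ s)) := by
  borelize E
  refine Measurable.stronglyMeasurable (mα := 𝓕.predictable) ?_
  intro B hB
  have e : Function.uncurry (fun s => W (gridPoint δ s)) ⁻¹' B =
      ⋃ k : ℕ, {s | ⌈s / δ⌉₊ - 1 = k} ×ˢ (W (k * δ) ⁻¹' B) := by
    ext ⟨s, ω⟩
    simp [gridPoint]
  rw [e]
  refine MeasurableSet.iUnion fun k => ?_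
  have hA : MeasurableSet[𝓕 (k * δ)] (W (k * δ) ⁻¹' B) := (hW _).measurable hB
  have hIoc := measurableSet_predictable_Ioc_prod (k * δ) ((k + 1) * δ) hA
  have hceil : ∀ s : ℝ≥0, ⌈s / δ⌉₊ = k + 1 ↔ s ∈ Set.Ioc (k * δ) ((k + 1) * δ) := by
    intro s
    rw [Nat.ceil_eq_iff k.succ_ne_zero, Set.mem_Ioc, lt_div_iff₀ hδ, div_le_iff₀ hδ]
    simp
  -- Truncated subtraction puts `s = 0` in the cell `k = 0`, which needs the extra rectangle over
  -- `{⊥}`.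
  obtain rfl | hk := Nat.eq_zero_or_pos k
  · have hset : {s : ℝ≥0 | ⌈s / δ⌉₊ - 1 = 0} =
        {⊥} ∪ Set.Ioc (((0 : ℕ) : ℝ≥0) * δ) (((0 : ℕ) + 1) * δ) := by
      ext s
      rw [Set.mem_union, ← hceil s, Set.mem_singleton_iff, Set.mem_ofPred_eq]
      have h0 : ⌈s / δ⌉₊ = 0 ↔ s = ⊥ := by
        rw [Nat.ceil_eq_zero, nonpos_iff_eq_zero, div_eq_zero_iff, or_iff_left hδ.ne']
        rfl
      rw [← h0]
      lia
    rw [hset, Set.union_prod]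
    refine MeasurableSet.union (measurableSet_predictable_singleton_bot_prod ?_) hIoc
    have hz : ((0 : ℕ) : ℝ≥0) * δ = ⊥ := by simp
    rw [hz] at hA ⊢
    exact hA
  · have hset : {s : ℝ≥0 | ⌈s / δ⌉₊ - 1 = k} = Set.Ioc (k * δ) ((k + 1) * δ) := by
      ext s
      rw [← hceil s, Set.mem_ofPred_eq]
      lia
    rw [hset]
    exact hIoc

/-- Continuity in probability is uniform on `[0, N]`, by a Lebesgue number of a cover by balls. -/
theorem exists_uniform_continuity_inMeasure (hc : ∀ t, TendstoInMeasure P W (𝓝 t) (W t))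
    (N : ℝ≥0) {ε : ℝ≥0∞} (hε : 0 < ε) :
    ∃ δ : ℝ≥0, 0 < δ ∧ ∀ u ≤ N, ∀ v, dist v u ≤ δ → P {ω | ε ≤ edist (W v ω) (W u ω)} ≤ ε := by
  have h : ∀ t, ∃ r > 0, ∀ s, dist s t < r → P {ω | ε / 2 ≤ edist (W s ω) (W t ω)} ≤ ε / 2 :=
    fun t => Metric.eventually_nhds_iff.1 ((hc t _ (ENNReal.half_pos hε.ne')).eventually
      (Iic_mem_nhds (ENNReal.half_pos hε.ne'))) |>.imp fun r hr => ⟨hr.1, fun s hs => hr.2 hs⟩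
  choose r hr hrP using h
  obtain ⟨δ, hδ, hb⟩ := lebesgue_number_lemma_of_metric (isCompact_Icc (a := (0 : ℝ≥0)) (b := N))
    (c := fun t => Metric.ball t (r t)) (fun _ => Metric.isOpen_ball)
    (fun t _ => Set.mem_iUnion.2 ⟨t, Metric.mem_ball_self (hr t)⟩)
  refine ⟨⟨δ / 2, by positivity⟩, half_pos hδ, fun u hu v hv => ?_⟩
  obtain ⟨t, ht⟩ := hb u ⟨zero_le, hu⟩
  have hut := hrP t u (ht (Metric.mem_ball_self hδ))
  have hvt := hrP t v (ht (Metric.mem_ball.2 (hv.trans_lt (half_lt_self hδ))))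
  calc P {ω | ε ≤ edist (W v ω) (W u ω)}
      ≤ P ({ω | ε / 2 ≤ edist (W v ω) (W t ω)} ∪ {ω | ε / 2 ≤ edist (W u ω) (W t ω)}) := by
        refine measure_mono fun ω hω => ?_
        by_contra hcon
        simp only [Set.mem_union, Set.mem_ofPred_eq, not_or, not_le] at hcon hω
        have := (edist_triangle_right (W v ω) (W u ω) (W t ω)).trans_lt
          (ENNReal.add_lt_add hcon.1 hcon.2)
        rw [ENNReal.add_halves] at this
        exact absurd hω (not_le.2 this)
    _ ≤ ε / 2 + ε / 2 := (measure_union_le _ _).trans (add_le_add hvt hut)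
    _ = ε := ENNReal.add_halves ε

/-- An adapted process that is continuous in probability has a predictable modification. -/
theorem exists_predictable_modification [CompleteSpace E] [SecondCountableTopology E]
    (hW : ∀ t, StronglyMeasurable[𝓕 t] (W t)) (hc : ∀ t, TendstoInMeasure P W (𝓝 t) (W t)) :
    ∃ V : ℝ≥0 → Ω → E, IsStronglyPredictable 𝓕 V ∧ ∀ t, V t =ᵐ[P] W t := by
  have hpos : ∀ n : ℕ, 0 < ((2 : ℝ≥0∞)⁻¹) ^ n := fun n => ENNReal.pow_pos (by simp) n
  choose δ hδ hδP using fun n : ℕ => exists_uniform_continuity_inMeasure hc n (hpos n)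
  have hV := fun n => isStronglyPredictable_gridPoint hW (hδ n)
  -- `limUnder` stays measurable where no limit exists. At fixed `t` the errors are summable from `n
  -- ≥ t` on, and Borel–Cantelli gives the limit `W t`.
  refine ⟨fun s ω => limUnder atTop fun n => W (gridPoint (δ n) s) ω, ?_, fun t => ?_⟩
  · exact @StronglyMeasurable.limUnder ℕ (ℝ≥0 × Ω) E 𝓕.predictable _ _ atTop _
      (fun n => Function.uncurry (fun s => W (gridPoint (δ n) s))) _ _ hV
  · obtain ⟨K, hK⟩ := exists_nat_ge t
    have hle : ∀ n, K ≤ n →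
        P {ω | ((2 : ℝ≥0∞)⁻¹) ^ n ≤ edist (W (gridPoint (δ n) t) ω) (W t ω)} ≤ 2⁻¹ ^ n :=
      fun n hn => hδP n t (hK.trans (by exact_mod_cast hn)) _ (dist_gridPoint_le (hδ n) t)
    have hsum : ∑' n, P {ω | ((2 : ℝ≥0∞)⁻¹) ^ (n + K) ≤
        edist (W (gridPoint (δ (n + K)) t) ω) (W t ω)} ≠ ∞ := by
      refine ne_top_of_le_ne_top ?_ (ENNReal.tsum_le_tsum fun n =>
        (hle (n + K) (by lia)).trans (pow_le_pow_right_of_le_one' (by simp) (Nat.le_add_right n K)))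
      rw [ENNReal.tsum_geometric, ENNReal.one_sub_inv_two, inv_inv]
      exact ENNReal.ofNat_ne_top
    filter_upwards [ae_eventually_notMem hsum] with ω hω
    refine Tendsto.limUnder_eq ((tendsto_add_atTop_iff_nat K).1 ?_)
    rw [tendsto_iff_edist_tendsto_0]
    refine tendsto_of_tendsto_of_tendsto_of_le_of_le' tendsto_const_nhds
      ((ENNReal.tendsto_pow_atTop_nhds_zero_of_lt_one (r := 2⁻¹)
        (by simp)).comp (tendsto_add_atTop_nat K)) (Eventually.of_forall fun _ => zero_le) ?_
    filter_upwards [hω] with n hn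
    rw [not_le] at hn
    exact hn.le

end Predictable

/-- The sums over `[0, t]` are `𝓕 t`-measurable, and some sequence of them converges almost surely.
-/
theorem IsStochConvolution.exists_stronglyMeasurable {Ω U H : Type*} {m : MeasurableSpace Ω}
    {P : Measure Ω} {𝓕 : Filtration ℝ≥0 m} [NormedAddCommGroup U] [NormedSpace ℝ U]
    [MeasurableSpace U] [BorelSpace U] [SecondCountableTopology U] [NormedAddCommGroup H]
    [NormedSpace ℝ H] [CompleteSpace H] [SecondCountableTopology H] {Φ : ℝ≥0 → U →L[ℝ] H}
    {Y : ℝ≥0 → Ω → U} (hY : Adapted 𝓕 Y) {t : ℝ≥0} {J : Ω → H}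
    (hJ : IsStochConvolution P Φ Y t J) :
    ∃ W : Ω → H, StronglyMeasurable[𝓕 t] W ∧ W =ᵐ[P] J := by
  borelize H
  obtain ⟨ns, -, hns⟩ := hJ.2.exists_seq_tendsto_ae'
  refine ⟨fun ω => limUnder atTop fun n =>
    stieltjesSum (fun s => Φ (t - s)) Y (ns n) (ns n).pt ω, ?_, ?_⟩
  · refine @StronglyMeasurable.limUnder ℕ Ω H (𝓕 t) _ _ atTop _
      (fun n => stieltjesSum (fun s => Φ (t - s)) Y (ns n) (ns n).pt) _ _ fun n => ?_
    refine Measurable.stronglyMeasurable (mα := 𝓕 t) ?_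
    exact measurable_stieltjesSum (m := 𝓕 t) (ns n) _
      fun i hi => (hY _).mono (𝓕.mono ((ns n).pt_le hi)) le_rfl
  · filter_upwards [hns] with ω hω using hω.limUnder_eq

theorem tendstoInMeasure_of_tendsto_lintegral_rpow {ι Ω E : Type*} {m : MeasurableSpace Ω}
    {P : Measure Ω} [NormedAddCommGroup E] {l : Filter ι} {p : ℝ} (hp : 0 < p) {f : ι → Ω → E}
    {g : Ω → E} (hf : ∀ i, AEStronglyMeasurable (f i) P) (hg : AEStronglyMeasurable g P)
    (h : Tendsto (fun i => ∫⁻ ω, ‖f i ω - g ω‖ₑ ^ p ∂P) l (𝓝 0)) :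
    TendstoInMeasure P f l g := by
  refine tendstoInMeasure_of_ne_top fun ε hε hε' => ?_
  have hεp : ε ^ p ≠ 0 := (ENNReal.rpow_pos hε hε').ne'
  have hεp' : ε ^ p ≠ ∞ := ENNReal.rpow_ne_top_of_nonneg hp.le hε'
  have h1 := ENNReal.Tendsto.div_const h (Or.inr hεp)
  rw [ENNReal.zero_div] at h1
  refine tendsto_of_tendsto_of_tendsto_of_le_of_le tendsto_const_nhds h1 (fun _ => zero_le)
    fun i => ?_
  refine (measure_mono fun ω hω => ?_).trans
    (meas_ge_le_lintegral_div ((((hf i).sub hg).enorm).pow_const p) hεp hεp')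
  rw [Set.mem_ofPred_eq, edist_eq_enorm_sub] at hω
  exact ENNReal.rpow_le_rpow hω hp.le

/-! ### The main theorem. -/

/-- The constants `C t` are chosen before the space `U`, the stochastic basis and the process `Y`:
they depend only on `t`, on `p` and on the semigroup. -/
theorem proposition2p4 {H : Type*} [NormedAddCommGroup H] [InnerProductSpace ℝ H]
    [CompleteSpace H] [TopologicalSpace.SeparableSpace H]
    (S : ℝ≥0 → H →L[ℝ] H) (hS : IsC0Semigroup S) (p : ℝ) (hp : 0 < p) :
    ∃ C : ℝ≥0 → ℝ≥0,
      ∀ (U : Type*) [NormedAddCommGroup U] [InnerProductSpace ℝ U] [CompleteSpace U]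
        [MeasurableSpace U] [BorelSpace U]
        (j : H →L[ℝ] U) (_ : Function.Injective j) (_ : DenseRange j)
        (_ : ∀ t : ℝ≥0, 0 < t → t ≤ 1 → ∃ T : U →L[ℝ] H, T.comp j = S t)
        (Ω : Type*) [m : MeasurableSpace Ω] (P : Measure Ω) [IsProbabilityMeasure P]
        (𝓕 : Filtration ℝ≥0 m) (_ : UsualConditions 𝓕 P)
        (Y : ℝ≥0 → Ω → U) (_ : Adapted 𝓕 Y) (_ : IsLevyProcess Y P)
        (I : ℝ≥0 → Ω → H)
        (_ : ∀ t : ℝ≥0, 0 < t → t ≤ 1 →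
          IsStochIntegral P (fun s => boundedExtension j (S s)) Y t (I t))
        (γ : ℝ≥0∞) (_ : γ = ⨆ t ∈ Set.Ioc (0 : ℝ≥0) 1, ∫⁻ ω, ‖I t ω‖ₑ ^ p ∂P) (_ : γ < ∞)
        (_ : Tendsto (fun t => ∫⁻ ω, ‖I t ω‖ₑ ^ p ∂P) (𝓝[>] 0) (𝓝 0)),
        -- the stochastic convolution is well defined at every time
        (∀ t : ℝ≥0, ∃ J : Ω → H,
          IsStochConvolution P (fun s => boundedExtension j (S s)) Y t J) ∧
        ∀ YA : ℝ≥0 → Ω → H,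
          (∀ t : ℝ≥0,
            IsStochConvolution P (fun s => boundedExtension j (S s)) Y t (YA t)) →
          -- the moment estimate
          (∀ t : ℝ≥0, ∫⁻ ω, ‖YA t ω‖ₑ ^ p ∂P ≤ γ * C t) ∧
          -- continuity in `p`-th mean
          (∀ t : ℝ≥0, Tendsto (fun s => ∫⁻ ω, ‖YA s ω - YA t ω‖ₑ ^ p ∂P) (𝓝 t) (𝓝 0)) ∧
          -- a predictable modification
          (∃ V : ℝ≥0 → Ω → H, IsStronglyPredictable 𝓕 V ∧ ∀ t : ℝ≥0, V t =ᵐ[P] YA t) := by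
  -- For `t > 0`, `[0, t]` is cut into `⌈t⌉₊ + 1` equal steps of length at most one; at `t = 0` the
  -- convolution vanishes.
  refine ⟨fun t => if t = 0 then 0 else momentConst p ‖S (t / (⌈t⌉₊ + 1))‖₊ ⌈t⌉₊, ?_⟩
  intro U _ _ _ _ _ j _ hj hext Ω m P _ 𝓕 _ Y hYa hY I hI γ hγ hγt hI0
  have hsep : TopologicalSpace.SeparableSpace U := hj.separableSpace j.continuous
  have hU : SecondCountableTopology U := UniformSpace.secondCountable_of_separable U
  have hH : SecondCountableTopology H := UniformSpace.secondCountable_of_separable H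
  have hm : ∀ s, Measurable (Y s) := fun s => (hYa s).mono (𝓕.le s) le_rfl
  have hΦ := fun s t (ht : 0 < t) => boundedExtension_add hS hj hext s ht
  have hγI : ∀ t : ℝ≥0, 0 < t → t ≤ 1 → ∫⁻ ω, ‖I t ω‖ₑ ^ p ∂P ≤ γ := fun t h0 h1 => by
    rw [hγ]
    exact le_iSup₂ (f := fun t (_ : t ∈ Set.Ioc (0 : ℝ≥0) 1) => ∫⁻ ω, ‖I t ω‖ₑ ^ p ∂P) t ⟨h0, h1⟩
  refine ⟨fun t => ?_, fun YA hYA => ?_⟩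
  · obtain ⟨J, hJ⟩ := hY.exists_convolution hS hΦ hm hI 0 t
    exact ⟨J, isStochConvolution_shiftedProcess_zero_iff.1 hJ⟩
  have hmom : ∀ t : ℝ≥0, ∫⁻ ω, ‖YA t ω‖ₑ ^ p ∂P ≤ γ *
      ((if t = 0 then 0 else momentConst p ‖S (t / (⌈t⌉₊ + 1))‖₊ ⌈t⌉₊ : ℝ≥0) : ℝ≥0∞) := by
    intro t
    obtain rfl | ht := eq_zero_or_pos t
    · have e : ∫⁻ ω, ‖YA 0 ω‖ₑ ^ p ∂P = 0 := by
        rw [lintegral_congr_ae (g := fun _ => 0), lintegral_zero]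
        filter_upwards [(hYA 0).ae_eq (isStochConvolution_zero_time _ _)] with ω hω
        simp [hω, hp]
      simp [e]
    · have hn : (0 : ℝ≥0) < ⌈t⌉₊ + 1 := by positivity
      rw [if_neg ht.ne']
      refine hY.lintegral_convolution_le hp.le hS hΦ hm hI hγI (by positivity)
        ((div_le_one₀ hn).2 ((Nat.le_ceil t).trans le_self_add)) ⌈t⌉₊ (c := 0) ?_
      rw [mul_div_cancel₀ _ hn.ne']
      exact isStochConvolution_shiftedProcess_zero_iff.2 (hYA t)
  have hcont := hY.tendsto_lintegral_convolution hp hS hΦ hm hI hI0 hYA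
    fun t => (hmom t).trans_lt (ENNReal.mul_lt_top hγt ENNReal.coe_lt_top)
  refine ⟨hmom, hcont, ?_⟩
  choose W hW hWYA using fun t => (hYA t).exists_stronglyMeasurable hYa
  have hc : ∀ t, TendstoInMeasure P W (𝓝 t) (W t) := fun t =>
    (tendstoInMeasure_of_tendsto_lintegral_rpow hp (fun s => (hYA s).1) (hYA t).1
      (hcont t)).congr (fun s => (hWYA s).symm) (hWYA t).symm
  obtain ⟨V, hV, hVW⟩ := exists_predictable_modification hW hc
  exact ⟨V, hV, fun t => (hVW t).trans (hWYA t)⟩
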